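/- **Cauchy's Integral Formula.** Let $n\ge 0$ and let $\mathrm{Cl}_n$ be the real Clifford algebra with generators $e_1,\dots,e_n$ and relations $e_ie_j+e_je_i=-2\delta_{ij}$; let $a\mapsto\bar a$ be Clifford conjugation (the linear anti-automorphism with $\bar e_j=-e_j$). Fix a sign $s\in\{1,-1\}$ and put $u_0=1$, $u_j=s\,e_j$ for $1\le j\le n$; identify $z=(z_0,\dots,z_n)\in\mathbb R^{n+1}$ with $\sum_{j=0}^n z_ju_j\in\mathrm{Cl}_n$ where needed. Let $\Omega\subset\mathbb R^{n+1}$ be a bounded open set with $C^1$ boundary (near each boundary point $\Omega$ is $\{\rho<0\}$ for a $C^1$ function $\rho$ with non-vanishing gradient), let $$E(z)=\frac{\Gamma(\frac{n+1}{2})}{2\pi^{(n+1)/2}}\,\frac{\overline{z}}{|z|^{n+1}}$$ be the Cauchy kernel, and let $d\sigma=\sum_{j=0}^n(-1)^j u_j\,dx_0\wedge\dots\wedge[dx_j]\wedge\dots\wedge dx_n$ be the oriented surface element, that is, $d\sigma=\sum_{j=0}^n\nu_ju_j\,dS$ on $\partial\Omega$, with $\nu$ the outward unit normal and $dS$ the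 surface area. Let $V$ be a real Banach space that is a left $\mathrm{Cl}_n$-module on which each element of $\mathrm{Cl}_n$ acts continuously (for example $V=\mathrm{Cl}_n$), and let $M$ be a bounded linear operator on $V$ commuting with the action of $e_1,\dots,e_n$. Let $\mathfrak M_M(\Omega)$ be the set of functions $f$ with values in $V$, continuous on $\overline\Omega$ and differentiable in $\Omega$, with $$\frac{\partial f}{\partial y_0}=-s\sum_{j=1}^n e_j\frac{\partial f}{\partial y_j}+Mf\quad\text{in }\Omega .$$ 1. If $f\in\mathfrak M_M(\Omega)$, then for every $x\notin\partial\Omega$ the following integral converges absolutely and $$e^{x_0M}\int_{\partial\Omega}E(y-x)\,d\sigma_y\,e^{-y_0M}f(y)=\begin{cases}f(x),&x\in\Omega,\\0,&x\notin\overline\Omega.\end{cases}$$ 2. Let $V=\mathrm{Cl}_n$, $\lambda\in\mathrm{Cl}_n$, and let $M=M_\lambda$ be multiplication by $\lambda$ from the right. If $f\in\mathfrak M_{\lambda}(\Omega):=\mathfrak M_{M_\lambda}(\Omega)$, then for every $x\notin\partial\Omega$ the following integral converges absolutely and $$\int_{\partial\Omega}E(y-x)\,d\sigma_y\,f(y)\,e^{(x_0-y_0)\lambda}=\begin{cases}f(x),&x\in\Omega,\\0,&x\notin\overline\Omega.\end{cases}$$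 3. If moreover $\lambda\in\mathbb R$, then for $f\in\mathfrak M_\lambda(\Omega)$ and every $x\notin\partial\Omega$ the following integral converges absolutely and $$\int_{\partial\Omega}E(y-x)\,e^{(x_0-y_0)\lambda}\,d\sigma_y\,f(y)=\begin{cases}f(x),&x\in\Omega,\\0,&x\notin\overline\Omega.\end{cases}$$ -/

import Mathlib

open MeasureTheory Set

noncomputable section

namespace CliffordCauchy

/-! ### The real Clifford algebra with `n` generators -/

/-- The quadratic form `-(x₁² + ⋯ + xₙ²)` on `ℝⁿ`. -/
def cliffordForm (n : ℕ) : QuadraticForm ℝ (Fin n → ℝ) :=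
  QuadraticMap.weightedSumSquares ℝ (fun _ : Fin n => (-1 : ℝ))

/-- The real Clifford algebra `Cl_n`. -/
abbrev Cl (n : ℕ) : Type := CliffordAlgebra (cliffordForm n)

/-- The generator `e_j` of `Cl_n` (the index `j : Fin n` stands for `j + 1` in `1, …, n`). -/
def e {n : ℕ} (j : Fin n) : Cl n := CliffordAlgebra.ι (cliffordForm n) (Pi.single j 1)

theorem e_mul_self {n : ℕ} (j : Fin n) : e j * e j = (-1 : Cl n) := by
  unfold e
  rw [CliffordAlgebra.ι_sq_scalar]
  have : cliffordForm n (Pi.single j 1) = -1 := by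
    simp [cliffordForm, QuadraticMap.weightedSumSquares_apply, Pi.single_apply]
  rw [this, map_neg, map_one]

theorem e_mul_e {n : ℕ} {i j : Fin n} (h : i ≠ j) : (e i * e j : Cl n) = -(e j * e i) := by
  unfold e
  refine CliffordAlgebra.ι_mul_ι_comm_of_isOrtho ?_
  simp only [QuadraticMap.isOrtho_def, cliffordForm, QuadraticMap.weightedSumSquares_apply,
    Pi.add_apply, smul_eq_mul, ← Finset.sum_add_distrib]
  refine Finset.sum_congr rfl fun k _ => ?_
  by_cases hi : k = i
  · subst hi
    simp [h]
  · simp [hi]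

/-- The generators satisfy `e_i e_j + e_j e_i = -2 δ_ij`. -/
theorem e_anticomm {n : ℕ} (i j : Fin n) :
    e i * e j + e j * e i = (if i = j then -2 else 0 : Cl n) := by
  split_ifs with h
  · subst h
    rw [e_mul_self]
    norm_num
  · rw [e_mul_e h]
    simp

/-- Auxiliary subspaces: the span of all increasing products of the first `k` generators. -/
def incSpan (n : ℕ) : ℕ → Submodule ℝ (Cl n)
  | 0 => ℝ ∙ 1
  | k + 1 => incSpan n k ⊔
      if h : k < n then (incSpan n k).map (LinearMap.mulRight ℝ (e ⟨k, h⟩)) else ⊥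

theorem incSpan_fg (n k : ℕ) : (incSpan n k).FG := by
  induction k with
  | zero => exact Submodule.fg_span_singleton _
  | succ k ih =>
    rw [incSpan]
    refine ih.sup ?_
    split_ifs
    · exact ih.map _
    · exact Submodule.fg_bot

theorem one_mem_incSpan (n k : ℕ) : (1 : Cl n) ∈ incSpan n k := by
  induction k with
  | zero => exact Submodule.mem_span_singleton_self _
  | succ k ih => exact Submodule.mem_sup_left ih

theorem e_mul_incSpan_of_le (n k : ℕ) (j : Fin n) (hj : k ≤ j) (a : Cl n) (ha : a ∈ incSpan n k) :
    ∃ b ∈ incSpan n k, e j * a = b * e j := by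
  induction k generalizing a with
  | zero =>
    obtain ⟨c, rfl⟩ := Submodule.mem_span_singleton.1 ha
    exact ⟨_, ha, by simp⟩
  | succ k ih =>
    rw [incSpan, dif_pos (by omega)] at ha ⊢
    obtain ⟨u, hu, v, hv, rfl⟩ := Submodule.mem_sup.1 ha
    obtain ⟨w, hw, rfl⟩ := hv
    obtain ⟨u', hu', h1⟩ := ih (by omega) u hu
    obtain ⟨w', hw', h2⟩ := ih (by omega) w hw
    refine ⟨u' - w' * e ⟨k, by omega⟩, Submodule.sub_mem _ (Submodule.mem_sup_left hu')
      (Submodule.mem_sup_right ⟨w', hw', rfl⟩), ?_⟩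
    have hne : j ≠ ⟨k, by omega⟩ := fun h => by
      have := congrArg Fin.val h
      simp at this
      omega
    rw [LinearMap.mulRight_apply, mul_add, h1, ← mul_assoc, h2, mul_assoc, e_mul_e hne, sub_mul,
      mul_neg, mul_assoc, sub_eq_add_neg]

theorem e_mul_incSpan (n k : ℕ) (j : Fin n) (hj : (j : ℕ) < k) (a : Cl n) (ha : a ∈ incSpan n k) :
    e j * a ∈ incSpan n k := by
  induction k generalizing a with
  | zero => omega
  | succ k ih =>
    rw [incSpan] at ha ⊢
    obtain ⟨u, hu, v, hv, rfl⟩ := Submodule.mem_sup.1 ha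
    rw [mul_add]
    by_cases hk : k < n
    · rw [dif_pos hk] at hv ⊢
      obtain ⟨w, hw, rfl⟩ := hv
      rw [LinearMap.mulRight_apply, ← mul_assoc]
      rcases Nat.lt_succ_iff_lt_or_eq.1 hj with h | h
      · exact Submodule.add_mem _ (Submodule.mem_sup_left (ih h u hu))
          (Submodule.mem_sup_right ⟨_, ih h w hw, rfl⟩)
      · obtain rfl : j = ⟨k, hk⟩ := Fin.ext h
        obtain ⟨u', hu', h1⟩ := e_mul_incSpan_of_le n k ⟨k, hk⟩ le_rfl u hu
        obtain ⟨w', hw', h2⟩ := e_mul_incSpan_of_le n k ⟨k, hk⟩ le_rfl w hw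
        rw [h1, h2, mul_assoc, e_mul_self, mul_neg_one]
        exact Submodule.add_mem _ (Submodule.mem_sup_right ⟨_, hu', rfl⟩)
          (Submodule.neg_mem _ (Submodule.mem_sup_left hw'))
    · rw [dif_neg hk, Submodule.mem_bot] at hv
      rw [hv, mul_zero, add_zero]
      exact Submodule.mem_sup_left (ih (by omega) u hu)

instance instFiniteCl (n : ℕ) : Module.Finite ℝ (Cl n) := by
  refine ⟨?_⟩
  suffices h : incSpan n n = ⊤ from h ▸ incSpan_fg n n
  rw [Submodule.eq_top_iff']
  intro a
  induction a using CliffordAlgebra.left_induction with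
  | algebraMap r =>
    rw [Algebra.algebraMap_eq_smul_one]
    exact Submodule.smul_mem _ _ (one_mem_incSpan n n)
  | add x y hx hy => exact Submodule.add_mem _ hx hy
  | ι_mul x m hx =>
    have : CliffordAlgebra.ι (cliffordForm n) m = ∑ j, m j • e j := by
      conv_lhs => rw [pi_eq_sum_univ m]
      rw [map_sum]
      refine Finset.sum_congr rfl fun j _ => ?_
      rw [map_smul, e]
      congr 2
      ext i
      simp [Pi.single_apply, eq_comm]
    rw [this, Finset.sum_mul]
    refine Submodule.sum_mem _ fun j _ => ?_
    rw [smul_mul_assoc]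
    exact Submodule.smul_mem _ _ (e_mul_incSpan n n j j.2 x hx)

attribute [local instance] Matrix.linftyOpNormedRing Matrix.linftyOpNormedAlgebra

/-- `Cl_n` is finite-dimensional, so all norms on it are equivalent and the choice does not matter
for continuity, derivatives and integrals.  We take a submultiplicative one, the operator norm of
the left multiplication in a basis. -/
instance instNormedRingCl (n : ℕ) : NormedRing (Cl n) :=
  NormedRing.induced (Cl n) (Matrix _ _ ℝ)
    (Algebra.leftMulMatrix (Module.finBasis ℝ (Cl n))).toRingHom
    (Algebra.leftMulMatrix_injective _)

instance instNormedAlgebraCl (n : ℕ) : NormedAlgebra ℝ (Cl n) :=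
  NormedAlgebra.induced ℝ (Cl n) (Matrix _ _ ℝ) (Algebra.leftMulMatrix (Module.finBasis ℝ (Cl n)))

/-! ### Paravectors, Cauchy kernel, oriented surface element -/

/-- The space `ℝ^{n+1}`, with coordinates `y 0, …, y n`. -/
abbrev Pt (n : ℕ) : Type := EuclideanSpace ℝ (Fin (n + 1))

/-- The units of the generalized Cauchy-Riemann operator `∑ⱼ unit s j ∂ⱼ = ∂₀ + s ∑_{j≥1} eⱼ ∂ⱼ`:
`unit s 0 = 1` and `unit s j = s eⱼ` for `1 ≤ j ≤ n`, where `s = 1` or `s = -1`. -/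
def unit {n : ℕ} (s : ℝ) (j : Fin (n + 1)) : Cl n :=
  Fin.cases 1 (fun i => s • e i) j

/-- The paravector `z₀ + s (e₁ z₁ + ⋯ + eₙ zₙ)` belonging to the point `z`. -/
def paravector {n : ℕ} (s : ℝ) (z : Pt n) : Cl n := ∑ j, z j • unit s j

/-- The Cauchy kernel `E(z) = Γ((n+1)/2) / (2 π^{(n+1)/2}) · z̄ / |z|^{n+1}`.  Here `star` is the
Clifford conjugation, the anti-automorphism with `star (e j) = - e j`. -/
def cauchyKernel {n : ℕ} (s : ℝ) (z : Pt n) : Cl n :=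
  (Real.Gamma (((n : ℝ) + 1) / 2) / (2 * Real.pi ^ (((n : ℝ) + 1) / 2)) / ‖z‖ ^ (n + 1)) •
    star (paravector s z)

/-- `ρ` is a `C¹` defining function of `Ω` in the open neighbourhood `U` of `p`. -/
structure IsDefiningFunction {n : ℕ} (Ω : Set (Pt n)) (p : Pt n) (U : Set (Pt n))
    (ρ : Pt n → ℝ) : Prop where
  isOpen : IsOpen U
  mem : p ∈ U
  contDiffOn : ContDiffOn ℝ 1 ρ U
  gradient_ne_zero : ∀ q ∈ U, gradient ρ q ≠ 0
  mem_iff : ∀ q ∈ U, q ∈ Ω ↔ ρ q < 0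

/-- A bounded open set with `C¹` boundary. -/
structure IsNiceDomain {n : ℕ} (Ω : Set (Pt n)) : Prop where
  isOpen : IsOpen Ω
  isBounded : Bornology.IsBounded Ω
  c1_boundary : ∀ p ∈ frontier Ω, ∃ U ρ, IsDefiningFunction Ω p U ρ

/-- `v` is the outward unit normal of `Ω` at the boundary point `p`. -/
def IsOutwardUnitNormal {n : ℕ} (Ω : Set (Pt n)) (p v : Pt n) : Prop :=
  ∃ U ρ, IsDefiningFunction Ω p U ρ ∧ v = ‖gradient ρ p‖⁻¹ • gradient ρ p

/-- The outward unit normal of `Ω` at a boundary point (it does not depend on the defining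
function). -/
def outwardNormal {n : ℕ} (Ω : Set (Pt n)) (p : Pt n) : Pt n :=
  Classical.epsilon fun v => IsOutwardUnitNormal Ω p v

/-- The `Cl_n`-valued differential form
`∑ⱼ (-1)^j unit s j dx₀ ∧ ⋯ ∧ [dxⱼ] ∧ ⋯ ∧ dxₙ` evaluated at the vectors `t₁, …, tₙ`. -/
def surfaceForm {n : ℕ} (s : ℝ) (t : Fin n → Pt n) : Cl n :=
  ∑ j : Fin (n + 1),
    ((-1) ^ (j : ℕ) * (Matrix.of fun i k : Fin n => t i (j.succAbove k)).det) • unit s j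

/-- On a positively oriented orthonormal tangent frame `t₁, …, tₙ` (that is, `ν, t₁, …, tₙ` is a
positively oriented orthonormal basis, `ν` the outward unit normal) the form takes the
value `∑ⱼ νⱼ unit s j`.  Hence the integral of `a · dσ · f` over the oriented boundary is the
integral of `a · (∑ⱼ νⱼ unit s j) · f` with respect to the surface area. -/
theorem surfaceForm_eq_paravector {n : ℕ} (s : ℝ) (ν : Pt n) (t : Fin n → Pt n)
    (h : Orthonormal ℝ (Fin.cons ν t : Fin (n + 1) → Pt n))
    (hdet : (Matrix.of fun i k => (Fin.cons ν t : Fin (n + 1) → Pt n) i k).det = 1) :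
    surfaceForm s t = paravector s ν := by
  set A : Matrix (Fin (n + 1)) (Fin (n + 1)) ℝ :=
    Matrix.of fun i k => (Fin.cons ν t : Fin (n + 1) → Pt n) i k with hA
  have hAt : A * A.transpose = 1 := by
    ext i k
    have := orthonormal_iff_ite.1 h i k
    rw [PiLp.inner_apply] at this
    simp only [Matrix.mul_apply, Matrix.transpose_apply, Matrix.one_apply, hA, Matrix.of_apply]
    rw [← this]
    exact Finset.sum_congr rfl fun j _ => by simp [mul_comm]
  have hadj : A.adjugate = A.transpose := by
    calc A.adjugate = A.adjugate * (A * A.transpose) := by rw [hAt, mul_one]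
      _ = A.transpose := by rw [← mul_assoc, Matrix.adjugate_mul, hdet, one_smul, one_mul]
  unfold surfaceForm paravector
  refine Finset.sum_congr rfl fun j _ => ?_
  congr 1
  have h1 : A.adjugate j 0 = ν j := by
    rw [hadj, Matrix.transpose_apply]
    simp [hA]
  rw [← h1, Matrix.adjugate_fin_succ_eq_det_submatrix]
  congr 2
  simp

/-- The density of the oriented surface element `dσ` with respect to the surface area on `∂Ω`. -/
def surfaceElement {n : ℕ} (s : ℝ) (Ω : Set (Pt n)) (y : Pt n) : Cl n :=
  paravector s (outwardNormal Ω y)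

/-- The partial derivative `∂f/∂y_j`. -/
def partialDeriv {n : ℕ} {V : Type*} [NormedAddCommGroup V] [NormedSpace ℝ V]
    (j : Fin (n + 1)) (f : Pt n → V) (y : Pt n) : V :=
  fderiv ℝ f y (EuclideanSpace.single j 1)

/-- The space `M_M(Ω)`: functions continuous on the closure of `Ω` that solve
`∂f/∂y₀ = -s ∑_{j≥1} eⱼ ∂f/∂yⱼ + M f` in `Ω`. -/
structure IsMSolution {n : ℕ} {V : Type*} [NormedAddCommGroup V] [NormedSpace ℝ V]
    [Module (Cl n) V] (s : ℝ) (M : V →L[ℝ] V) (Ω : Set (Pt n)) (f : Pt n → V) : Prop where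
  continuousOn : ContinuousOn f (closure Ω)
  differentiableOn : DifferentiableOn ℝ f Ω
  eqn : ∀ y ∈ Ω, partialDeriv 0 f y =
    -(s • ∑ j : Fin n, (e j : Cl n) • partialDeriv j.succ f y) + M (f y)

/-- The operator `M_λ` of multiplication from the right by `λ`. -/
def rightMul {n : ℕ} (l : Cl n) : Cl n →L[ℝ] Cl n := (ContinuousLinearMap.mul ℝ (Cl n)).flip l

end CliffordCauchy

end

/-!
Write `D = ∑ⱼ uⱼ ∂ⱼ` for the Cauchy-Riemann operator with `u₀ = 1`, `uⱼ = s eⱼ`. If `f` satisfies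
`D f = M f` and `M` commutes with the Clifford units, then `g = exp (-y₀ M) f` satisfies `D g = 0`
(`IsMSolution.sum_unit_smul_partialDeriv_eq_zero`), so everything reduces to the formula for
`M = 0` (`cauchy_formula`); the statements on right multiplication by `λ` and on real `λ` are
special cases, because the exponential of a right multiplication is the right multiplication by
the exponential, and real numbers are central.

For `D g = 0`, the Cauchy kernel is replaced by the smooth kernel
`E_ε(z) = c z̄ / (|z|² + ε²) ^ ((n + 1) / 2)` with the same constant `c`. The Gauss-Green formula
for the field with components `E_ε(y - x) uⱼ g(y)` says that the boundary integral with `E_ε` in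
place of `E` equals `∫_Ω (E_ε D)(y - x) g(y) dy`. Now
`E_ε D = c (n + 1) ε² / (|z|² + ε²) ^ ((n + 3) / 2)` is an explicit approximate identity. Hence,
as `ε` tends to `0`, the volume integral tends to `g x` or `0`, according as `x ∈ Ω` or
`x ∉ closure Ω`, while the boundary integral tends to the one with `E`, because `x` is not on the
boundary.

The Gauss-Green formula (`HasContinuousDiv.integral_eq_integral_normalFlux`) is proved for a
bounded domain with `C¹` boundary, the surface measure being the Hausdorff measure, and for fields
that are continuous on the closure and differentiable inside, with a divergence that extends
continuously; the partial derivatives need not be integrable. Multiply the field by a cutoff `χ`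
supported near a boundary point `p` with defining function `ρ`, and by `θ(-T ρ)`, which vanishes
near the boundary and tends to the indicator of `Ω` as `T → ∞`. The divergence theorem on boxes,
which needs differentiability only, then expresses `∫_Ω div (χ F)` by an integral over a thin slab
along the boundary. A chart taking `ρ` to a coordinate, with an isometry as derivative at `p`, is
`(1 - c)⁻¹`-Lipschitz in both directions for any prescribed `c > 0`, if the neighbourhood of `p` is
small. Hence it distorts the volume of the slabs and the Hausdorff measure of the boundary only by
factors close to `1`, and both sides of the Gauss-Green formula agree up to `τ ∫ χ dS`, with `τ`
as small as desired. Summing over a partition of unity bounds the total error by `τ` times the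
area of the boundary. In this way no area formula is needed: comparing with the tangent hyperplane
at `p` is enough.
-/

noncomputable section

namespace CliffordCauchy

open Filter Topology NNReal ENNReal

/-! ### Divergence of compactly supported fields -/

/-- A compactly supported differentiable vector field has divergence of mean zero.  No continuity
of the partial derivatives is needed, only integrability of their sum. -/
theorem integral_sum_partialDeriv_eq_zero {n : ℕ} {X : Type*} [NormedAddCommGroup X]
    [NormedSpace ℝ X] {F : Fin (n + 1) → Pt n → X}
    (hF : ∀ j, Differentiable ℝ (F j)) (hc : ∀ j, HasCompactSupport (F j))
    (hint : Integrable fun y => ∑ j, partialDeriv j (F j) y) :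
    ∫ y, ∑ j, partialDeriv j (F j) y = 0 := by
  obtain ⟨R, hR0, hR⟩ : ∃ R : ℝ, 0 < R ∧ ∀ j y, R ≤ ‖y‖ → F j y = 0 := by
    have h : ∀ j, ∃ R : ℝ, ∀ y, R ≤ ‖y‖ → F j y = 0 := fun j => by
      obtain ⟨R, hR⟩ := (hc j).isCompact.isBounded.subset_ball 0
      refine ⟨R, fun y hy => image_eq_zero_of_notMem_tsupport fun hmem => ?_⟩
      have := hR hmem
      rw [mem_ball_zero_iff] at this
      linarith
    choose R hR using h
    refine ⟨1 + ∑ j, |R j|, by positivity, fun j y hy => hR j y ?_⟩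
    have := Finset.single_le_sum (f := fun j => |R j|) (fun i _ => abs_nonneg _)
      (Finset.mem_univ j)
    have h2 := le_abs_self (R j)
    linarith
  -- hence the faces of the cube `[-R, R]ⁿ⁺¹` do not contribute
  have hcoord : ∀ j (x : Fin (n + 1) → ℝ), (∃ i, R ≤ |x i|) → F j (WithLp.toLp 2 x) = 0 := by
    rintro j x ⟨i, hi⟩
    refine hR j _ (hi.trans ?_)
    have := PiLp.norm_apply_le (WithLp.toLp 2 x : Pt n) i
    simpa using this
  let L : (Fin (n + 1) → ℝ) ≃L[ℝ] Pt n := (PiLp.continuousLinearEquiv 2 ℝ _).symm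
  have hL : ∀ x, L x = WithLp.toLp 2 x := fun x => rfl
  have hvol := PiLp.volume_preserving_toLp (Fin (n + 1))
  have hemb := (MeasurableEquiv.toLp 2 (Fin (n + 1) → ℝ)).measurableEmbedding
  have hsingle : ∀ i : Fin (n + 1), L (Pi.single i 1) = EuclideanSpace.single i 1 := fun i => rfl
  have hdiv := integral_divergence_of_hasFDerivAt_off_countable' (fun _ => -R) (fun _ => R)
    (fun _ => by simp; linarith) (fun j x => F j (L x))
    (fun j x => (fderiv ℝ (F j) (L x)).comp (L : (Fin (n + 1) → ℝ) →L[ℝ] Pt n)) ∅ countable_empty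
    (fun j => ((hF j).continuous.comp L.continuous).continuousOn)
    (fun x _ j => ((hF j) (L x)).hasFDerivAt.comp x L.hasFDerivAt)
    (((hvol.integrable_comp_emb hemb).2 hint).integrableOn)
  have hrhs : ∀ i : Fin (n + 1), ((∫ x in Icc ((fun _ => -R) ∘ i.succAbove)
      ((fun _ => R) ∘ i.succAbove), F i (L (i.insertNth R x))) -
        ∫ x in Icc ((fun _ => -R) ∘ i.succAbove)
      ((fun _ => R) ∘ i.succAbove), F i (L (i.insertNth (-R) x))) = 0 := by
    intro i
    have h1 : ∀ x : Fin n → ℝ, F i (L (i.insertNth R x)) = 0 := fun x =>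
      hcoord i _ ⟨i, by simp [le_abs_self]⟩
    have h2 : ∀ x : Fin n → ℝ, F i (L (i.insertNth (-R) x)) = 0 := fun x =>
      hcoord i _ ⟨i, by simp [le_abs_self]⟩
    simp only [h1, h2]
    simp
  rw [Finset.sum_eq_zero fun i _ => hrhs i] at hdiv
  rw [← hvol.integral_comp hemb, ← hdiv, eq_comm]
  refine setIntegral_eq_integral_of_forall_compl_eq_zero fun x hx => ?_
  refine Finset.sum_eq_zero fun j _ => ?_
  have hx' : ∃ i, R < |x i| := by
    by_contra! h
    exact hx ⟨fun i => (abs_le.1 (h i)).1, fun i => (abs_le.1 (h i)).2⟩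
  obtain ⟨i, hi⟩ := hx'
  have hev : F j =ᶠ[𝓝 (L x)] fun _ => 0 := by
    have : ∀ᶠ y : Pt n in 𝓝 (L x), R < |y i| :=
      (isOpen_lt continuous_const (by fun_prop : Continuous fun y : Pt n => |y i|)).mem_nhds hi
    filter_upwards [this] with y hy
    exact hcoord j _ ⟨i, hy.le⟩
  simp [hev.fderiv_eq]

/-! ### A cutoff function and the limit of thin slabs -/

/-- A profile for cutting off near the boundary: `θ` vanishes on `(-∞, 1]`, equals `1` on `[2, ∞)`,
and its derivative `η` is nonnegative, continuous and of integral one. -/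
theorem exists_cutoff_profile : ∃ θ η : ℝ → ℝ, (∀ t, HasDerivAt θ (η t) t) ∧ Continuous η ∧
    (∀ t, 0 ≤ η t) ∧ ∫ t, η t = 1 ∧ (∀ t ≤ 1, θ t = 0) ∧ (∀ t, 2 ≤ t → θ t = 1) ∧
    (∀ t, 0 ≤ θ t) ∧ (∀ t, θ t ≤ 1) ∧ (∀ t ∉ Ioo 1 2, η t = 0) := by
  set θ : ℝ → ℝ := fun t => Real.smoothTransition (t - 1) with hθ
  have hsm : ContDiff ℝ 1 θ := (Real.smoothTransition.contDiff (n := 1)).comp (by fun_prop)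
  have hd : ∀ t, HasDerivAt θ (deriv θ t) t := fun t =>
    (hsm.differentiable one_ne_zero t).hasDerivAt
  have hcont : Continuous (deriv θ) := hsm.continuous_deriv le_rfl
  have hmono : Monotone θ := fun a b h => Real.smoothTransition.monotone (by linarith)
  have h0 : ∀ t ≤ 1, θ t = 0 := fun t ht => Real.smoothTransition.zero_of_nonpos (by linarith)
  have h1 : ∀ t, 2 ≤ t → θ t = 1 := fun t ht => Real.smoothTransition.one_of_one_le (by linarith)
  have hz : ∀ t ∉ Ioo (1 : ℝ) 2, deriv θ t = 0 := by
    have hcl : ∀ t ∈ Iio (1 : ℝ) ∪ Ioi 2, deriv θ t = 0 := by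
      rintro t (ht | ht)
      · have : θ =ᶠ[𝓝 t] fun _ => 0 := by
          filter_upwards [Iio_mem_nhds ht] with u hu using h0 u (le_of_lt hu)
        simp [this.deriv_eq]
      · have : θ =ᶠ[𝓝 t] fun _ => 1 := by
          filter_upwards [Ioi_mem_nhds ht] with u hu using h1 u (le_of_lt hu)
        simp [this.deriv_eq]
    have hc2 : ∀ t ∈ closure (Iio (1 : ℝ) ∪ Ioi 2), deriv θ t = 0 := fun t ht =>
      closure_minimal (s := Iio (1 : ℝ) ∪ Ioi 2) (t := {t | deriv θ t = 0}) hcl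
        (isClosed_eq hcont continuous_const) ht
    intro t ht
    refine hc2 t ?_
    rw [closure_union, closure_Iio, closure_Ioi]
    by_contra h
    simp only [mem_union, mem_Iic, mem_Ici, not_or, not_le] at h
    exact ht ⟨h.1, h.2⟩
  have hsupp : HasCompactSupport (deriv θ) :=
    HasCompactSupport.intro (isCompact_Icc (a := (1 : ℝ)) (b := 2))
      fun t ht => hz t fun h => ht ⟨h.1.le, h.2.le⟩
  refine ⟨θ, deriv θ, hd, hcont, fun t => hmono.deriv_nonneg, ?_, h0, h1,
    fun t => Real.smoothTransition.nonneg _, fun t => Real.smoothTransition.le_one _, hz⟩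
  have := integral_of_hasDerivAt_of_tendsto hd (hcont.integrable_of_hasCompactSupport hsupp)
    (m := 0) (n := 1)
    (tendsto_const_nhds.congr' (by
      filter_upwards [Iic_mem_atBot 1] with t ht using (h0 t ht).symm))
    (tendsto_const_nhds.congr' (by
      filter_upwards [Ici_mem_atTop 2] with t ht using (h1 t ht).symm))
  simpa using this

/-- The inclusion of the coordinate hyperplane `{y | y 0 = 0}`. -/
def hyperplaneIncl {n : ℕ} (x : EuclideanSpace ℝ (Fin n)) : Pt n :=
  WithLp.toLp 2 (Fin.cons 0 x.ofLp)

theorem isometry_hyperplaneIncl {n : ℕ} :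
    Isometry (hyperplaneIncl : EuclideanSpace ℝ (Fin n) → Pt n) := by
  refine Isometry.of_dist_eq fun x y => ?_
  simp [EuclideanSpace.dist_eq, hyperplaneIncl, Fin.sum_univ_succ]

theorem range_hyperplaneIncl {n : ℕ} :
    range (hyperplaneIncl : EuclideanSpace ℝ (Fin n) → Pt n) = {y | y 0 = 0} := by
  ext y
  constructor
  · rintro ⟨x, rfl⟩
    simp [hyperplaneIncl]
  · intro hy
    refine ⟨WithLp.toLp 2 fun i => y i.succ, ?_⟩
    ext i
    refine Fin.cases ?_ (fun i => ?_) i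
    · simpa [hyperplaneIncl] using (show y 0 = 0 from hy).symm
    · simp [hyperplaneIncl]

theorem integral_eq_integral_cons {n : ℕ} {G : Pt n → ℝ} (hG : Integrable G) :
    ∫ w, G w = ∫ t : ℝ, ∫ x : Fin n → ℝ, G (WithLp.toLp 2 (Fin.cons t x)) := by
  have hvol := PiLp.volume_preserving_toLp (Fin (n + 1))
  have hemb := (MeasurableEquiv.toLp 2 (Fin (n + 1) → ℝ)).measurableEmbedding
  have hp := (volume_preserving_piFinSuccAbove (fun _ : Fin (n + 1) => ℝ) 0).symm
  have hemb2 :=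
    (MeasurableEquiv.piFinSuccAbove (fun _ : Fin (n + 1) => ℝ) 0).symm.measurableEmbedding
  have hi := (hp.integrable_comp_emb hemb2).2 ((hvol.integrable_comp_emb hemb).2 hG)
  rw [← hvol.integral_comp hemb, ← hp.integral_comp hemb2]
  refine (integral_prod _ hi).trans ?_
  refine integral_congr_ae (.of_forall fun t => integral_congr_ae (.of_forall fun x => ?_))
  simp [MeasurableEquiv.piFinSuccAbove, Fin.insertNthEquiv]

/-- Averages over the slabs `{-2/c < w 0 < -1/c}` tend to the integral over the hyperplane. -/
theorem tendsto_integral_slab {n : ℕ} {η : ℝ → ℝ} (hη : Continuous η) (hη0 : ∀ t, 0 ≤ η t)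
    (hη1 : ∫ t, η t = 1) (hη2 : ∀ t ∉ Ioo 1 2, η t = 0)
    {k : Pt n → ℝ} (hk : Continuous k) (hks : HasCompactSupport k) :
    Tendsto (fun c : ℝ => ∫ w : Pt n, c * η (-(c * w 0)) * k w) atTop
      (𝓝 (∫ x, k (hyperplaneIncl x))) := by
  obtain ⟨R, hR⟩ := hks.isCompact.isBounded.subset_ball 0
  have hk0 : ∀ t (x : Fin n → ℝ), x ∉ Metric.closedBall (0 : Fin n → ℝ) R →
      k (WithLp.toLp 2 (Fin.cons t x)) = 0 := by
    intro t x hx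
    refine image_eq_zero_of_notMem_tsupport fun hm => hx ?_
    have h1 := mem_ball_zero_iff.1 (hR hm)
    rw [mem_closedBall_zero_iff, pi_norm_le_iff_of_nonneg ((norm_nonneg _).trans h1.le)]
    intro i
    have h2 := PiLp.norm_apply_le (WithLp.toLp 2 (Fin.cons t x) : Pt n) i.succ
    simp only [Fin.cons_succ] at h2
    exact h2.trans h1.le
  set K : ℝ → ℝ := fun t => ∫ x : Fin n → ℝ, k (WithLp.toLp 2 (Fin.cons t x)) with hK
  have hcons : Continuous fun q : ℝ × (Fin n → ℝ) => (WithLp.toLp 2 (Fin.cons q.1 q.2) : Pt n) := by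
    refine (PiLp.continuous_toLp 2 _).comp (continuous_pi fun i => ?_)
    refine Fin.cases ?_ (fun i => ?_) i
    · simpa using continuous_fst
    · simp only [Fin.cons_succ]; fun_prop
  have hKc : Continuous K := by
    have h1 : K = fun t => ∫ x in Metric.closedBall (0 : Fin n → ℝ) R,
        k (WithLp.toLp 2 (Fin.cons t x)) := by
      funext t
      exact (setIntegral_eq_integral_of_forall_compl_eq_zero fun x hx => hk0 t x hx).symm
    rw [h1]
    exact continuous_parametric_integral_of_continuous (f := fun t (x : Fin n → ℝ) =>
      k (WithLp.toLp 2 (Fin.cons t x))) (hk.comp hcons) (isCompact_closedBall _ _)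
  have hKs : HasCompactSupport K := by
    refine HasCompactSupport.intro (isCompact_closedBall (0 : ℝ) R) fun t ht => ?_
    refine integral_eq_zero_of_ae (Eventually.of_forall fun x => ?_)
    refine image_eq_zero_of_notMem_tsupport fun hm => ht ?_
    have h1 := mem_ball_zero_iff.1 (hR hm)
    have h2 := PiLp.norm_apply_le (WithLp.toLp 2 (Fin.cons t x) : Pt n) 0
    rw [mem_closedBall_zero_iff]
    simp only [Fin.cons_zero] at h2
    exact h2.trans h1.le
  have hlim := tendsto_integral_comp_smul_smul_of_integrable' (F := ℝ) (μ := volume) (φ := η) hη0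
    hη1 (?_) (g := K) (x₀ := 0) (hKc.integrable_of_hasCompactSupport hKs) hKc.continuousAt
  · have hK0 : K 0 = ∫ x, k (hyperplaneIncl x) :=
      ((PiLp.volume_preserving_toLp (Fin n)).integral_comp
        (MeasurableEquiv.toLp 2 (Fin n → ℝ)).measurableEmbedding (fun x => k (hyperplaneIncl x)))
    rw [← hK0]
    refine hlim.congr fun c => ?_
    have hint : Integrable fun w : Pt n => c * η (-(c * w 0)) * k w :=
      (by fun_prop : Continuous fun w : Pt n => c * η (-(c * w 0)) * k w
        ).integrable_of_hasCompactSupport hks.mul_left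
    rw [integral_eq_integral_cons hint]
    simp [hK, integral_const_mul]
  · refine tendsto_const_nhds.congr' ?_
    filter_upwards [tendsto_norm_cobounded_atTop.eventually_ge_atTop 2] with t ht
    rw [hη2 t, mul_zero]
    rintro ⟨h1, h2⟩
    rw [Real.norm_of_nonneg (by linarith)] at ht
    linarith

/-! ### Hausdorff measures under bi-Lipschitz maps -/

section BiLipschitz

variable {X Y : Type*} [MetricSpace X] [MeasurableSpace X] [BorelSpace X] [MetricSpace Y]
  [MeasurableSpace Y] [BorelSpace Y]

theorem euclideanHausdorffMeasure_image_le {f : X → Y} {K : ℝ≥0} {A : Set X}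
    (hf : LipschitzOnWith K f A) (d : ℕ) : μHE[d] (f '' A) ≤ (K : ℝ≥0∞) ^ d * μHE[d] A := by
  simp_rw [Measure.euclideanHausdorffMeasure_def, Measure.smul_apply, ENNReal.smul_def, smul_eq_mul]
  rw [mul_left_comm]
  gcongr
  simpa using hf.hausdorffMeasure_image_le (d := d) (by positivity)

theorem restrict_image_le_map {f : X → Y} {K : ℝ≥0} {A : Set X} (hA : MeasurableSet A)
    (hf : LipschitzOnWith K f A) (d : ℕ) :
    (μHE[d] : Measure Y).restrict (f '' A) ≤
      (K : ℝ≥0∞) ^ d • ((μHE[d] : Measure X).restrict A).map f := by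
  refine Measure.le_iff.2 fun B hB => ?_
  rw [Measure.restrict_apply hB, Measure.smul_apply, smul_eq_mul,
    Measure.map_apply_of_aemeasurable (hf.continuousOn.aemeasurable hA) hB,
    Measure.restrict_apply' hA, inter_comm B, ← image_inter_preimage, inter_comm A]
  exact euclideanHausdorffMeasure_image_le (hf.mono inter_subset_right) d

theorem map_restrict_le {f : X → Y} {g : Y → X} {K : ℝ≥0} {A : Set X} (hA : MeasurableSet A)
    (hf : ContinuousOn f A) (hg : LipschitzOnWith K g (f '' A)) (hgf : LeftInvOn g f A) (d : ℕ) :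
    ((μHE[d] : Measure X).restrict A).map f ≤
      (K : ℝ≥0∞) ^ d • (μHE[d] : Measure Y).restrict (f '' A) := by
  refine Measure.le_iff.2 fun B hB => ?_
  rw [Measure.smul_apply, smul_eq_mul, Measure.restrict_apply hB,
    Measure.map_apply_of_aemeasurable (hf.aemeasurable hA) hB, Measure.restrict_apply' hA]
  have h : f ⁻¹' B ∩ A = g '' (B ∩ f '' A) := by
    ext x
    constructor
    · rintro ⟨hxB, hxA⟩
      exact ⟨f x, ⟨hxB, x, hxA, rfl⟩, hgf hxA⟩
    · rintro ⟨_, ⟨hyB, x, hxA, rfl⟩, rfl⟩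
      rw [hgf hxA]
      exact ⟨hyB, hxA⟩
  rw [h]
  exact euclideanHausdorffMeasure_image_le (hg.mono inter_subset_right) d

/-- A map that is `K`-Lipschitz together with its inverse changes integrals of nonnegative functions
with respect to the `d`-dimensional Hausdorff measure at most by the factor `K ^ d`. -/
theorem integral_comp_bilipschitz {f : X → Y} {g : Y → X} {K : ℝ≥0} {A : Set X}
    (hA : MeasurableSet A) (hf : LipschitzOnWith K f A) (hg : LipschitzOnWith K g (f '' A))
    (hgf : LeftInvOn g f A) (d : ℕ) {G : Y → ℝ} (hG0 : ∀ y, 0 ≤ G y)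
    (hGi : IntegrableOn G (f '' A) μHE[d]) :
    IntegrableOn (fun x => G (f x)) A μHE[d] ∧
      ∫ x in A, G (f x) ∂μHE[d] ≤ K ^ d * ∫ y in f '' A, G y ∂μHE[d] ∧
      ∫ y in f '' A, G y ∂μHE[d] ≤ K ^ d * ∫ x in A, G (f x) ∂μHE[d] := by
  have hfm : AEMeasurable f ((μHE[d] : Measure X).restrict A) := hf.continuousOn.aemeasurable hA
  have hK : ((K : ℝ≥0∞) ^ d) ≠ ∞ := ENNReal.pow_ne_top ENNReal.coe_ne_top
  have hle := map_restrict_le hA hf.continuousOn hg hgf d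
  have hi : Integrable G (((μHE[d] : Measure X).restrict A).map f) :=
    (hGi.smul_measure hK).mono_measure hle
  have hmap : ∫ y, G y ∂(((μHE[d] : Measure X).restrict A).map f) = ∫ x in A, G (f x) ∂μHE[d] :=
    integral_map hfm hi.aestronglyMeasurable
  refine ⟨(integrable_map_measure hi.aestronglyMeasurable hfm).1 hi, ?_, ?_⟩
  · rw [← hmap]
    refine (integral_mono_measure hle (.of_forall hG0) (hGi.smul_measure hK)).trans_eq ?_
    rw [integral_smul_measure]
    simp
  · rw [← hmap]
    refine (integral_mono_measure (restrict_image_le_map hA hf d) (.of_forall hG0)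
      (hi.smul_measure hK)).trans_eq ?_
    rw [integral_smul_measure]
    simp

end BiLipschitz

/-! ### Flattening a `C¹` boundary -/

theorem IsDefiningFunction.contDiffAt {n : ℕ} {Ω : Set (Pt n)} {p : Pt n} {U : Set (Pt n)}
    {ρ : Pt n → ℝ} (h : IsDefiningFunction Ω p U ρ) {q : Pt n} (hq : q ∈ U) :
    ContDiffAt ℝ 1 ρ q :=
  h.contDiffOn.contDiffAt (h.isOpen.mem_nhds hq)

theorem IsDefiningFunction.hasGradientAt {n : ℕ} {Ω : Set (Pt n)} {p : Pt n} {U : Set (Pt n)}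
    {ρ : Pt n → ℝ} (h : IsDefiningFunction Ω p U ρ) {q : Pt n} (hq : q ∈ U) :
    HasGradientAt ρ (gradient ρ q) q :=
  ((h.contDiffAt hq).differentiableAt one_ne_zero).hasGradientAt

/-- In a direction along which `ρ` decreases to first order, `ρ` becomes negative. -/
theorem eventually_neg_of_inner_neg {n : ℕ} {ρ : Pt n → ℝ} {a q v : Pt n}
    (h : HasGradientAt ρ a q) (h0 : ρ q = 0) (hv : inner ℝ a v < 0) :
    ∀ᶠ t : ℝ in 𝓝[>] 0, ρ (q + t • v) < 0 := by
  have hd : HasDerivAt (fun t : ℝ => ρ (q + t • v)) (inner ℝ a v) 0 := by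
    have h1 : HasFDerivAt ρ (InnerProductSpace.toDual ℝ _ a) (q + (0 : ℝ) • v) := by
      simpa using h.hasFDerivAt
    have h2 : HasDerivAt (fun t : ℝ => q + t • v) v 0 := by
      simpa using ((hasDerivAt_id (0 : ℝ)).smul_const v).const_add q
    exact (h1.comp_hasDerivAt (0 : ℝ) h2).congr_deriv (by simp)
  have hs := (hasDerivAt_iff_tendsto_slope.1 hd).mono_left
    (nhdsWithin_mono (0 : ℝ) (fun t (ht : 0 < t) => ht.ne' : Ioi (0 : ℝ) ⊆ {0}ᶜ))
  filter_upwards [hs.eventually (gt_mem_nhds hv), self_mem_nhdsWithin] with t ht ht0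
  simp only [slope_def_field, zero_smul, add_zero, h0, sub_zero] at ht
  by_contra! hcon
  exact absurd ht (not_lt.2 (div_nonneg hcon (le_of_lt ht0)))

theorem IsDefiningFunction.mem_frontier_iff {n : ℕ} {Ω : Set (Pt n)} {p : Pt n} {U : Set (Pt n)}
    {ρ : Pt n → ℝ} (h : IsDefiningFunction Ω p U ρ) (hΩ : IsOpen Ω) {q : Pt n} (hq : q ∈ U) :
    q ∈ frontier Ω ↔ ρ q = 0 := by
  rw [hΩ.frontier_eq]
  have hU := h.isOpen.mem_nhds hq
  constructor
  · rintro ⟨hcl, hn⟩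
    refine le_antisymm ?_ (not_lt.1 fun hlt => hn ((h.mem_iff q hq).2 hlt))
    by_contra! hpos
    have hev : ∀ᶠ y in 𝓝 q, 0 < ρ y := (h.contDiffAt hq).continuousAt.eventually (lt_mem_nhds hpos)
    obtain ⟨y, ⟨hy1, hy2⟩, hy3⟩ := mem_closure_iff_nhds.1 hcl _ (inter_mem hev hU)
    exact absurd ((h.mem_iff y hy2).1 hy3) (not_lt.2 (le_of_lt hy1))
  · intro h0
    refine ⟨?_, fun hin => by rw [h.mem_iff q hq, h0] at hin; exact lt_irrefl _ hin⟩
    have hneg := eventually_neg_of_inner_neg (v := -gradient ρ q) (h.hasGradientAt hq) h0 (by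
      rw [inner_neg_right, real_inner_self_eq_norm_sq, neg_lt_zero]
      exact pow_pos (norm_pos_iff.2 (h.gradient_ne_zero q hq)) 2)
    have htend : Tendsto (fun t : ℝ => q + t • -gradient ρ q) (𝓝[>] 0) (𝓝 q) := by
      have : Continuous fun t : ℝ => q + t • -gradient ρ q := by fun_prop
      simpa using (this.tendsto 0).mono_left nhdsWithin_le_nhds
    refine mem_closure_of_tendsto htend ?_
    filter_upwards [hneg, htend.eventually hU] with t ht htU
    exact (h.mem_iff _ htU).2 ht

/-- The outward unit normal does not depend on the defining function: a unit vector `b` with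
`⟪b, v⟫ ≤ 0` whenever `⟪a, v⟫ < 0` equals the unit vector `a`, as `v = b - a` shows. -/
theorem outwardNormal_eq {n : ℕ} {Ω : Set (Pt n)} (hΩ : IsOpen Ω) {p q : Pt n} {U : Set (Pt n)}
    {ρ : Pt n → ℝ} (h : IsDefiningFunction Ω p U ρ) (hq : q ∈ U) (hqf : q ∈ frontier Ω) :
    outwardNormal Ω q = ‖gradient ρ q‖⁻¹ • gradient ρ q := by
  have h' : IsDefiningFunction Ω q U ρ :=
    ⟨h.isOpen, hq, h.contDiffOn, h.gradient_ne_zero, h.mem_iff⟩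
  have hex : IsOutwardUnitNormal Ω q (‖gradient ρ q‖⁻¹ • gradient ρ q) := ⟨U, ρ, h', rfl⟩
  obtain ⟨U₂, ρ₂, h₂, hν⟩ : IsOutwardUnitNormal Ω q (outwardNormal Ω q) :=
    Classical.epsilon_spec (p := fun v => IsOutwardUnitNormal Ω q v) ⟨_, hex⟩
  rw [hν]
  have hn1 : 0 < ‖gradient ρ q‖ := norm_pos_iff.2 (h.gradient_ne_zero q hq)
  have hn2 : 0 < ‖gradient ρ₂ q‖ := norm_pos_iff.2 (h₂.gradient_ne_zero q h₂.mem)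
  set a := ‖gradient ρ q‖⁻¹ • gradient ρ q with ha
  set b := ‖gradient ρ₂ q‖⁻¹ • gradient ρ₂ q with hb
  have hna : ‖a‖ = 1 := norm_smul_inv_norm (h.gradient_ne_zero q hq)
  have hnb : ‖b‖ = 1 := norm_smul_inv_norm (h₂.gradient_ne_zero q h₂.mem)
  by_contra hne
  have hlt : inner ℝ a b < 1 := (inner_lt_one_iff_real_of_norm_eq_one hna hnb).2 (Ne.symm hne)
  have h1 : inner ℝ (gradient ρ q) (b - a) < 0 := by
    have : inner ℝ a (b - a) < 0 := by
      rw [inner_sub_right, real_inner_self_eq_norm_sq, hna]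
      linarith
    rw [ha, real_inner_smul_left] at this
    exact (pos_iff_neg_of_mul_neg this).1 (inv_pos.2 hn1)
  have h2 : inner ℝ (gradient ρ₂ q) (-(b - a)) < 0 := by
    have : 0 < inner ℝ b (b - a) := by
      rw [inner_sub_right, real_inner_self_eq_norm_sq, hnb, real_inner_comm]
      linarith
    rw [hb, real_inner_smul_left] at this
    rw [inner_neg_right, neg_lt_zero]
    exact (pos_iff_pos_of_mul_pos this).1 (inv_pos.2 hn2)
  have e1 := eventually_neg_of_inner_neg (h.hasGradientAt hq)
    ((h.mem_frontier_iff hΩ hq).1 hqf) h1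
  have hg2 := (h₂.hasGradientAt h₂.mem).hasFDerivAt.neg
  have e2 := eventually_neg_of_inner_neg (ρ := fun y => -ρ₂ y) (a := -gradient ρ₂ q)
    (v := b - a) (q := q) (by
      rw [hasGradientAt_iff_hasFDerivAt, map_neg]
      exact hg2) (by simp [(h₂.mem_frontier_iff hΩ h₂.mem).1 hqf])
      (by rwa [inner_neg_left, ← inner_neg_right])
  have htend : Tendsto (fun t : ℝ => q + t • (b - a)) (𝓝[>] 0) (𝓝 q) := by
    have : Continuous fun t : ℝ => q + t • (b - a) := by fun_prop
    simpa using (this.tendsto 0).mono_left nhdsWithin_le_nhds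
  obtain ⟨t, ht1, ht2, ht3, ht4⟩ := (e1.and (e2.and ((htend.eventually (h.isOpen.mem_nhds hq)).and
    (htend.eventually (h₂.isOpen.mem_nhds h₂.mem))))).exists
  have := (h₂.mem_iff _ ht4).1 ((h.mem_iff _ ht3).2 ht1)
  linarith

theorem continuousOn_outwardNormal {n : ℕ} {Ω : Set (Pt n)} (hΩ : IsNiceDomain Ω) :
    ContinuousOn (outwardNormal Ω) (frontier Ω) := by
  intro p hp
  obtain ⟨U, ρ, h⟩ := hΩ.c1_boundary p hp
  have hg : ContinuousAt (gradient ρ) p := by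
    have h1 : ContinuousAt (fderiv ℝ ρ) p :=
      ((h.contDiffAt h.mem).fderiv_right (m := 0) le_rfl).continuousAt
    exact (InnerProductSpace.toDual ℝ (Pt n)).symm.continuous.continuousAt.comp h1
  have hc : ContinuousAt (fun q => ‖gradient ρ q‖⁻¹ • gradient ρ q) p :=
    (hg.norm.inv₀ (norm_ne_zero_iff.2 (h.gradient_ne_zero p h.mem))).smul hg
  refine hc.continuousWithinAt.congr_of_eventuallyEq ?_ (outwardNormal_eq hΩ.isOpen h h.mem hp)
  filter_upwards [self_mem_nhdsWithin, mem_nhdsWithin_of_mem_nhds (h.isOpen.mem_nhds h.mem)]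
    with q hq hqU
  exact outwardNormal_eq hΩ.isOpen h hqU hq

/-- Near a boundary point there is a chart taking `ρ / ‖∇ρ(p)‖` to the first coordinate whose
derivative at `p` is an isometry (a reflection taking the normal to the first basis vector); hence
the chart is as close to isometric as desired. -/
theorem IsDefiningFunction.exists_flattening {n : ℕ} {Ω : Set (Pt n)} {p : Pt n} {U : Set (Pt n)}
    {ρ : Pt n → ℝ} (h : IsDefiningFunction Ω p U ρ) {c : ℝ≥0} (hc0 : 0 < c) (hc1 : c < 1) :
    ∃ Φ : OpenPartialHomeomorph (Pt n) (Pt n), p ∈ Φ.source ∧ Φ.source ⊆ U ∧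
      LipschitzOnWith (1 - c)⁻¹ Φ Φ.source ∧ LipschitzOnWith (1 - c)⁻¹ Φ.symm Φ.target ∧
      ∀ y ∈ Φ.source, Φ y 0 = ρ y / ‖gradient ρ p‖ := by
  have hn : 0 < ‖gradient ρ p‖ := norm_pos_iff.2 (h.gradient_ne_zero p h.mem)
  set ν : Pt n := ‖gradient ρ p‖⁻¹ • gradient ρ p with hν
  have hν1 : ‖ν‖ = 1 := norm_smul_inv_norm (h.gradient_ne_zero p h.mem)
  set e₀ : Pt n := EuclideanSpace.single 0 1 with he₀
  have he1 : ‖e₀‖ = 1 := by simp [he₀]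
  let R : Pt n ≃ₗᵢ[ℝ] Pt n := (ℝ ∙ (ν - e₀))ᗮ.reflection
  have hRν : R ν = e₀ := Submodule.reflection_sub (hν1.trans he1.symm)
  have hR0 : ∀ y, (R y) 0 = inner ℝ ν y := fun y => by
    rw [← R.inner_map_map, hRν, he₀, EuclideanSpace.inner_single_left]
    simp
  -- `f` replaces the first coordinate of `R y`, which is `⟪ν, y⟫`, by `ρ y / ‖∇ρ(p)‖`
  set f : Pt n → Pt n := fun y => R y + (ρ y / ‖gradient ρ p‖ - inner ℝ ν y) • e₀ with hf
  have hf0 : ∀ y, f y 0 = ρ y / ‖gradient ρ p‖ := fun y => by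
    simp [hf, he₀, hR0]
  have hstrict : HasStrictFDerivAt f (R.toContinuousLinearEquiv : Pt n →L[ℝ] Pt n) p := by
    have hρ : HasStrictFDerivAt ρ (InnerProductSpace.toDual ℝ _ (gradient ρ p)) p := by
      have := (h.contDiffAt h.mem).hasStrictFDerivAt one_ne_zero
      rwa [(h.hasGradientAt h.mem).hasFDerivAt.fderiv] at this
    have h1 := (((hρ.mul_const ‖gradient ρ p‖⁻¹).sub
      (innerSL ℝ ν).hasStrictFDerivAt).smul_const e₀)
    have h2 := (R.toContinuousLinearEquiv : Pt n →L[ℝ] Pt n).hasStrictFDerivAt (x := p) |>.add h1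
    refine h2.congr_fderiv ?_
    ext v : 1
    simp [hν]
  have hN : ‖(R.toContinuousLinearEquiv.symm : Pt n →L[ℝ] Pt n)‖₊ = 1 := by
    ext
    exact R.symm.toLinearIsometry.norm_toContinuousLinearMap
  have hN' : ‖(R.toContinuousLinearEquiv : Pt n →L[ℝ] Pt n)‖₊ = 1 := by
    ext
    exact R.toLinearIsometry.norm_toContinuousLinearMap
  obtain ⟨s, hs, hfs⟩ := hstrict.approximates_deriv_on_nhds (c := c) (Or.inr hc0)
  have hs' : interior s ∩ U ⊆ s := inter_subset_left.trans interior_subset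
  have hlin := hfs.mono_set hs'
  have hcN : Subsingleton (Pt n) ∨
      c < ‖(R.toContinuousLinearEquiv.symm : Pt n →L[ℝ] Pt n)‖₊⁻¹ :=
    Or.inr (by simpa [hN] using hc1)
  have hopen : IsOpen (interior s ∩ U) := isOpen_interior.inter h.isOpen
  refine ⟨hlin.toOpenPartialHomeomorph f _ hcN hopen, ⟨mem_interior_iff_mem_nhds.2 hs, h.mem⟩,
    inter_subset_right, ?_, ?_, fun y _ => hf0 y⟩
  · have h1 : LipschitzOnWith (1 + c) f (interior s ∩ U) := by
      have := lipschitzOnWith_iff_restrict.2 hlin.lipschitz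
      rwa [hN'] at this
    refine h1.weaken ?_
    have : (1 - c : ℝ≥0) ≠ 0 := (tsub_pos_of_lt hc1).ne'
    rw [← NNReal.coe_le_coe]
    push_cast [NNReal.coe_sub hc1.le]
    have hc1' : (c : ℝ) < 1 := by exact_mod_cast hc1
    rw [le_inv_comm₀ (by positivity) (by linarith), inv_eq_one_div, le_div_iff₀ (by positivity)]
    nlinarith [c.2]
  · have hanti := hlin.antilipschitz hcN
    rw [hN, inv_one] at hanti
    rintro _ ⟨x, hx, rfl⟩ _ ⟨y, hy, rfl⟩
    have hxx := (hlin.toOpenPartialHomeomorph f _ hcN hopen).left_inv hx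
    have hyy := (hlin.toOpenPartialHomeomorph f _ hcN hopen).left_inv hy
    have h3 := hanti ⟨x, hx⟩ ⟨y, hy⟩
    have e1 : (hlin.toOpenPartialHomeomorph f _ hcN hopen).symm (f x) = x := hxx
    have e2 : (hlin.toOpenPartialHomeomorph f _ hcN hopen).symm (f y) = y := hyy
    erw [e1, e2]
    exact h3

/-! ### Thin slabs and surface area -/

/-- In a chart that is `K`-Lipschitz in both directions, the weighted integral of `ψ` over a thin
slab along the boundary and the integral of `ψ` over the boundary agree, up to powers of `K`, with
the corresponding integrals `J c` over a flat slab and `S` over a flat hyperplane; and `J c` tends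
to `S` as the slab gets thin. -/
theorem IsDefiningFunction.slab_comparison {n : ℕ} {Ω : Set (Pt n)} {p : Pt n} {U : Set (Pt n)}
    {ρ : Pt n → ℝ} (h : IsDefiningFunction Ω p U ρ) (hΩ : IsOpen Ω) {K : ℝ≥0} {m : ℝ} (hm : 0 < m)
    {Φ : OpenPartialHomeomorph (Pt n) (Pt n)} (hΦU : Φ.source ⊆ U)
    (hΦ : LipschitzOnWith K Φ Φ.source) (hΦ' : LipschitzOnWith K Φ.symm Φ.target)
    (hΦ0 : ∀ y ∈ Φ.source, Φ y 0 = ρ y / m)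
    {η : ℝ → ℝ} (hη : Continuous η) (hη0 : ∀ t, 0 ≤ η t)
    (hη1 : ∫ t, η t = 1) (hη2 : ∀ t ∉ Ioo 1 2, η t = 0)
    {ψ : Pt n → ℝ} (hψ : Continuous ψ) (hψ0 : ∀ y, 0 ≤ ψ y) (hψc : HasCompactSupport ψ)
    (hψs : tsupport ψ ⊆ Φ.source) :
    ∃ (S : ℝ) (J : ℝ → ℝ), Tendsto J atTop (𝓝 S) ∧
      ∫ y in frontier Ω, ψ y ∂μHE[n] ≤ K ^ n * S ∧
      S ≤ K ^ n * ∫ y in frontier Ω, ψ y ∂μHE[n] ∧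
      ∀ c, 0 ≤ c → 0 ≤ J c ∧
        ∫ y, c * η (-(c * (ρ y / m))) * ψ y ≤ K ^ (n + 1) * J c ∧
        J c ≤ K ^ (n + 1) * ∫ y, c * η (-(c * (ρ y / m))) * ψ y := by
  set k : Pt n → ℝ := Φ.target.indicator (fun w => ψ (Φ.symm w)) with hk
  have hkΦ : ∀ y ∈ Φ.source, k (Φ y) = ψ y := fun y hy => by
    rw [hk, indicator_of_mem (Φ.map_source hy), Φ.left_inv hy]
  have hcomp : IsCompact (Φ '' tsupport ψ) := hψc.isCompact.image_of_continuousOn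
    (Φ.continuousOn.mono hψs)
  have hk0 : ∀ w ∉ Φ '' tsupport ψ, k w = 0 := fun w hw => by
    rw [hk, indicator_apply_eq_zero]
    intro hwt
    refine image_eq_zero_of_notMem_tsupport fun hmem => hw ⟨_, hmem, Φ.right_inv hwt⟩
  have hkc : HasCompactSupport k := HasCompactSupport.intro hcomp hk0
  have hknn : ∀ w, 0 ≤ k w := fun w => indicator_nonneg (fun w _ => hψ0 _) w
  have hkcont : Continuous k := by
    rw [continuous_iff_continuousAt]
    intro w
    by_cases hw : w ∈ Φ.target
    · have h1 : ContinuousAt (fun w => ψ (Φ.symm w)) w :=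
        hψ.continuousAt.comp (Φ.continuousAt_symm hw)
      refine h1.congr ?_
      filter_upwards [Φ.open_target.mem_nhds hw] with z hz
      rw [hk, indicator_of_mem hz]
    · have hw' : w ∉ Φ '' tsupport ψ := by
        rintro ⟨y, hy, rfl⟩
        exact hw (Φ.map_source (hψs hy))
      refine (continuousAt_const (y := (0 : ℝ))).congr ?_
      filter_upwards [hcomp.isClosed.isOpen_compl.mem_nhds hw'] with z hz using (hk0 z hz).symm
  have hψz : ∀ y ∉ Φ.source, ψ y = 0 := fun y hy =>
    image_eq_zero_of_notMem_tsupport fun hm => hy (hψs hm)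
  refine ⟨∫ x, k (hyperplaneIncl x), fun c => ∫ w : Pt n, c * η (-(c * w 0)) * k w,
    tendsto_integral_slab hη hη0 hη1 hη2 hkcont hkc, ?_⟩
  -- the surface: the chart takes the boundary into the hyperplane
  set A := Φ.source ∩ frontier Ω with hA
  have hAm : MeasurableSet A := Φ.open_source.measurableSet.inter isClosed_frontier.measurableSet
  have hAimg : Φ '' A = Φ.target ∩ range hyperplaneIncl := by
    rw [range_hyperplaneIncl]
    ext w
    constructor
    · rintro ⟨y, ⟨hy, hyf⟩, rfl⟩
      refine ⟨Φ.map_source hy, ?_⟩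
      change Φ y 0 = 0
      rw [hΦ0 y hy, (h.mem_frontier_iff hΩ (hΦU hy)).1 hyf, zero_div]
    · rintro ⟨hw, hw0⟩
      have hs := Φ.map_target hw
      refine ⟨Φ.symm w, ⟨hs, (h.mem_frontier_iff hΩ (hΦU hs)).2 ?_⟩, Φ.right_inv hw⟩
      have h1 : ρ (Φ.symm w) / m = 0 := by
        rw [← hΦ0 _ hs, Φ.right_inv hw]
        exact hw0
      exact (div_eq_zero_iff.1 h1).resolve_right hm.ne'
  have hrange : MeasurableSet (range (hyperplaneIncl : EuclideanSpace ℝ (Fin n) → Pt n)) :=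
    isometry_hyperplaneIncl.isClosedEmbedding.isClosed_range.measurableSet
  have hιm : Measurable (hyperplaneIncl : EuclideanSpace ℝ (Fin n) → Pt n) :=
    isometry_hyperplaneIncl.continuous.measurable
  have hmapι : (volume : Measure (EuclideanSpace ℝ (Fin n))).map hyperplaneIncl =
      (μHE[n] : Measure (Pt n)).restrict (range hyperplaneIncl) := by
    rw [← EuclideanSpace.euclideanHausdorffMeasure_eq_volume,
      isometry_hyperplaneIncl.map_euclideanHausdorffMeasure]
  have hkι : Integrable fun x => k (hyperplaneIncl x : Pt n) :=
    (hkcont.comp isometry_hyperplaneIncl.continuous).integrable_of_hasCompactSupport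
      (hkc.comp_isClosedEmbedding isometry_hyperplaneIncl.isClosedEmbedding)
  have hkrange : IntegrableOn k (range hyperplaneIncl) μHE[n] := by
    rw [IntegrableOn, ← hmapι]
    exact (integrable_map_measure hkcont.aestronglyMeasurable hιm.aemeasurable).2 hkι
  have hsurf := integral_comp_bilipschitz hAm (hΦ.mono inter_subset_left)
    (g := Φ.symm) (hΦ'.mono (by rw [hAimg]; exact inter_subset_left))
    (fun y hy => Φ.left_inv hy.1) n hknn (by
      rw [hAimg]; exact hkrange.mono_set inter_subset_right)
  have hint1 : ∫ w in Φ '' A, k w ∂μHE[n] = ∫ x, k (hyperplaneIncl x) := by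
    rw [hAimg, ← setIntegral_eq_of_subset_of_forall_sdiff_eq_zero hrange inter_subset_right,
      ← hmapι, integral_map hιm.aemeasurable hkcont.aestronglyMeasurable]
    intro w hw
    rw [hk, indicator_of_notMem fun hwt => hw.2 ⟨hwt, hw.1⟩]
  have hint2 : ∫ y in A, k (Φ y) ∂μHE[n] = ∫ y in frontier Ω, ψ y ∂μHE[n] := by
    rw [setIntegral_congr_fun hAm fun y hy => hkΦ y hy.1]
    symm
    refine setIntegral_eq_of_subset_of_forall_sdiff_eq_zero isClosed_frontier.measurableSet
      inter_subset_right fun y hy => hψz y fun hys => hy.2 ⟨hys, hy.1⟩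
  rw [hint1, hint2] at hsurf
  refine ⟨hsurf.2.1, hsurf.2.2, fun c hc => ?_⟩
  -- the slabs: volume is the Hausdorff measure of dimension `n + 1`
  have hvol : (μHE[n + 1] : Measure (Pt n)) = volume :=
    EuclideanSpace.euclideanHausdorffMeasure_eq_volume (n + 1)
  set G : Pt n → ℝ := fun w => c * η (-(c * w 0)) * k w with hG
  have hG0 : ∀ w, 0 ≤ G w := fun w => mul_nonneg (mul_nonneg hc (hη0 _)) (hknn w)
  have hGi : Integrable G :=
    (by fun_prop : Continuous G).integrable_of_hasCompactSupport hkc.mul_left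
  have himg : Φ '' Φ.source = Φ.target := Φ.image_source_eq_target
  have hvolc := integral_comp_bilipschitz Φ.open_source.measurableSet hΦ (g := Φ.symm)
    (by rwa [himg]) (fun y hy => Φ.left_inv hy) (n + 1) hG0
    (by rw [himg, hvol]; exact hGi.integrableOn)
  have hint3 : ∫ w in Φ '' Φ.source, G w ∂μHE[n + 1] = ∫ w, G w := by
    rw [himg, hvol]
    refine setIntegral_eq_integral_of_forall_compl_eq_zero fun w hw => ?_
    rw [hG]
    simp [hk, indicator_of_notMem hw]
  have hint4 : ∫ y in Φ.source, G (Φ y) ∂μHE[n + 1] =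
      ∫ y, c * η (-(c * (ρ y / m))) * ψ y := by
    rw [hvol]
    rw [setIntegral_congr_fun (g := fun y => c * η (-(c * (ρ y / m))) * ψ y)
      Φ.open_source.measurableSet fun y hy => by simp only [hG, hkΦ y hy, hΦ0 y hy]]
    refine setIntegral_eq_integral_of_forall_compl_eq_zero fun y hy => ?_
    rw [hψz y hy, mul_zero]
  rw [hint3, hint4] at hvolc
  exact ⟨integral_nonneg hG0, hvolc.2⟩

/-! ### The boundary has finite area -/

theorem measure_frontier_lt_top {n : ℕ} {Ω : Set (Pt n)} (hΩ : IsNiceDomain Ω) :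
    μHE[n] (frontier Ω) < ∞ := by
  have hcl : IsCompact (closure Ω) := hΩ.isBounded.isCompact_closure
  refine (hcl.of_isClosed_subset isClosed_frontier
    frontier_subset_closure).measure_lt_top_of_nhdsWithin fun p hp => ?_
  obtain ⟨U, ρ, h⟩ := hΩ.c1_boundary p hp
  obtain ⟨c, hc0, hc1⟩ := exists_between (zero_lt_one (α := ℝ≥0))
  obtain ⟨Φ, hpΦ, hΦU, -, hΦ', hΦ0⟩ := h.exists_flattening hc0 hc1
  have hV : Φ.source ∩ Φ ⁻¹' Metric.ball (Φ p) 1 ∈ 𝓝 p :=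
    inter_mem (Φ.open_source.mem_nhds hpΦ)
      ((Φ.continuousAt hpΦ).preimage_mem_nhds (Metric.ball_mem_nhds _ one_pos))
  refine ⟨frontier Ω ∩ (Φ.source ∩ Φ ⁻¹' Metric.ball (Φ p) 1),
    inter_mem self_mem_nhdsWithin (mem_nhdsWithin_of_mem_nhds hV), ?_⟩
  set B := Φ.target ∩ (Metric.ball (Φ p) 1 ∩ range hyperplaneIncl) with hB
  have hsub : frontier Ω ∩ (Φ.source ∩ Φ ⁻¹' Metric.ball (Φ p) 1) ⊆ Φ.symm '' B := by
    rintro y ⟨hyf, hys, hyb⟩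
    refine ⟨Φ y, ⟨Φ.map_source hys, hyb, ?_⟩, Φ.left_inv hys⟩
    rw [range_hyperplaneIncl]
    change Φ y 0 = 0
    rw [hΦ0 y hys, (h.mem_frontier_iff hΩ.isOpen (hΦU hys)).1 hyf, zero_div]
  have hB1 : μHE[n] B < ∞ := by
    refine (measure_mono inter_subset_right).trans_lt ?_
    rw [← isometry_hyperplaneIncl.euclideanHausdorffMeasure_preimage,
      EuclideanSpace.euclideanHausdorffMeasure_eq_volume]
    exact (isometry_hyperplaneIncl.antilipschitz.isBounded_preimage
      Metric.isBounded_ball).measure_lt_top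
  have hB2 := euclideanHausdorffMeasure_image_le (hΦ'.mono (inter_subset_left : B ⊆ Φ.target)) n
  exact ((measure_mono hsub).trans hB2).trans_lt
    (ENNReal.mul_lt_top (ENNReal.pow_lt_top ENNReal.coe_lt_top) hB1)

theorem integrableOn_frontier {n : ℕ} {Ω : Set (Pt n)} (hΩ : IsNiceDomain Ω) {X : Type*}
    [NormedAddCommGroup X] {f : Pt n → X} (hf : ContinuousOn f (frontier Ω)) :
    IntegrableOn f (frontier Ω) μHE[n] := by
  have hcl : IsCompact (frontier Ω) := hΩ.isBounded.isCompact_closure.of_isClosed_subset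
    isClosed_frontier frontier_subset_closure
  obtain ⟨C, hC⟩ := hcl.exists_bound_of_continuousOn hf
  exact IntegrableOn.of_bound (measure_frontier_lt_top hΩ)
    (hf.aestronglyMeasurable_of_isCompact hcl isClosed_frontier.measurableSet) C
    ((ae_restrict_iff' isClosed_frontier.measurableSet).2 (.of_forall hC))

/-! ### The Gauss-Green formula near a point -/

section GaussGreen

variable {n : ℕ} {Ω : Set (Pt n)} {X : Type*} [NormedAddCommGroup X] [NormedSpace ℝ X]

/-- The divergence of the field `χ F`, where `h` is the divergence of `F`. -/
def cutoffDiv (χ : Pt n → ℝ) (F : Fin (n + 1) → Pt n → X) (h : Pt n → X) (y : Pt n) : X :=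
  ∑ j, partialDeriv j χ y • F j y + χ y • h y

/-- The outward flux density `⟪ν, F⟫` of a field along the boundary. -/
def normalFlux (Ω : Set (Pt n)) (F : Fin (n + 1) → Pt n → X) (y : Pt n) : X :=
  ∑ j, outwardNormal Ω y j • F j y

/-- `F` is continuous on the closure of `Ω` and differentiable in `Ω`, and its divergence there is
a function `h` that is continuous on the closure; the partial derivatives themselves need not be
continuous, not even bounded. -/
structure HasContinuousDiv (Ω : Set (Pt n)) (F : Fin (n + 1) → Pt n → X) (h : Pt n → X) :
    Prop where
  continuousOn : ∀ j, ContinuousOn (F j) (closure Ω)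
  differentiableOn : ∀ j, DifferentiableOn ℝ (F j) Ω
  continuousOn_div : ContinuousOn h (closure Ω)
  div_eq : ∀ y ∈ Ω, ∑ j, partialDeriv j (F j) y = h y

variable {F : Fin (n + 1) → Pt n → X} {h : Pt n → X}

theorem cutoffDiv_eq_zero_of_eventuallyEq {χ : Pt n → ℝ} {y : Pt n} (hχ : χ =ᶠ[𝓝 y] fun _ => 0) :
    cutoffDiv χ F h y = 0 := by
  have h1 : ∀ j, partialDeriv j χ y = 0 := fun j => by
    rw [partialDeriv, hχ.fderiv_eq]
    simp
  simp [cutoffDiv, h1, hχ.eq_of_nhds]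

theorem cutoffDiv_eq_zero_of_notMem {χ : Pt n → ℝ} {y : Pt n} (hy : y ∉ tsupport χ) :
    cutoffDiv χ F h y = 0 :=
  cutoffDiv_eq_zero_of_eventuallyEq (notMem_tsupport_iff_eventuallyEq.1 hy)

theorem HasContinuousDiv.continuousWithinAt_cutoffDiv (hF : HasContinuousDiv Ω F h) {χ : Pt n → ℝ}
    {y : Pt n} (hχ : ContDiffAt ℝ 1 χ y) (hy : y ∈ closure Ω) :
    ContinuousWithinAt (cutoffDiv χ F h) (closure Ω) y := by
  have h1 : ContinuousAt (fderiv ℝ χ) y := (hχ.fderiv_right (m := 0) le_rfl).continuousAt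
  refine (tendsto_finsetSum _ fun j _ => ?_).add
    (hχ.continuousAt.continuousWithinAt.smul (hF.continuousOn_div y hy))
  exact (h1.clm_apply continuousAt_const).continuousWithinAt.smul (hF.continuousOn j y hy)

/-- A cutoff of `F` that vanishes near the boundary has divergence of mean zero. -/
theorem HasContinuousDiv.integral_cutoffDiv_eq_zero (hΩ : IsOpen Ω) (hF : HasContinuousDiv Ω F h)
    {G : Pt n → ℝ} (hGc : HasCompactSupport G)
    (hG : ∀ y, (y ∈ Ω ∧ ContDiffAt ℝ 1 G y) ∨ G =ᶠ[𝓝 y] fun _ => 0) :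
    Integrable (cutoffDiv G F h) ∧ ∫ y, cutoffDiv G F h y = 0 := by
  have hdiff : ∀ y, (∀ j, DifferentiableAt ℝ (fun z => G z • F j z) y) ∧
      ∑ j, partialDeriv j (fun z => G z • F j z) y = cutoffDiv G F h y := by
    intro y
    rcases hG y with ⟨hy, hGy⟩ | h0
    · have hGd := hGy.differentiableAt one_ne_zero
      have hFd := fun j => (hF.differentiableOn j).differentiableAt (hΩ.mem_nhds hy)
      refine ⟨fun j => hGd.smul (hFd j), ?_⟩
      rw [cutoffDiv, ← hF.div_eq y hy, Finset.smul_sum, ← Finset.sum_add_distrib]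
      refine Finset.sum_congr rfl fun j _ => ?_
      have hprod : HasFDerivAt (fun z => G z • F j z) _ y :=
        hGd.hasFDerivAt.smul (hFd j).hasFDerivAt
      rw [partialDeriv, hprod.fderiv]
      simp [partialDeriv, add_comm]
    · have h1 : ∀ j, (fun z => G z • F j z) =ᶠ[𝓝 y] fun _ => 0 := fun j => by
        filter_upwards [h0] with z hz
        rw [hz, zero_smul]
      refine ⟨fun j => (differentiableAt_const (0 : X)).congr_of_eventuallyEq (h1 j), ?_⟩
      rw [cutoffDiv_eq_zero_of_eventuallyEq h0]
      refine Finset.sum_eq_zero fun j _ => ?_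
      rw [partialDeriv, (h1 j).fderiv_eq]
      simp
  have hcont : Continuous (cutoffDiv G F h) := by
    rw [continuous_iff_continuousAt]
    intro y
    rcases hG y with ⟨hy, hGy⟩ | h0
    · exact (hF.continuousWithinAt_cutoffDiv hGy (subset_closure hy)).continuousAt
        (mem_of_superset (hΩ.mem_nhds hy) subset_closure)
    · refine (continuousAt_const (y := (0 : X))).congr ?_
      filter_upwards [eventually_eventually_nhds.2 h0] with z hz
      exact (cutoffDiv_eq_zero_of_eventuallyEq hz).symm
  have hint : Integrable (cutoffDiv G F h) := hcont.integrable_of_hasCompactSupport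
    (HasCompactSupport.intro hGc fun y hy => cutoffDiv_eq_zero_of_notMem hy)
  refine ⟨hint, ?_⟩
  have hz := integral_sum_partialDeriv_eq_zero (F := fun j z => G z • F j z)
    (fun j y => (hdiff y).1 j) (fun j => hGc.smul_right) (by simpa only [(hdiff _).2] using hint)
  simpa only [(hdiff _).2] using hz

theorem partialDeriv_eq_gradient {ρ : Pt n → ℝ} {y : Pt n} (hρ : DifferentiableAt ℝ ρ y)
    (j : Fin (n + 1)) : partialDeriv j ρ y = gradient ρ y j := by
  rw [partialDeriv, hρ.hasGradientAt.hasFDerivAt.fderiv, InnerProductSpace.toDual_apply_apply,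
    EuclideanSpace.inner_single_right]
  simp

theorem continuousOn_normalFlux (hΩ : IsNiceDomain Ω) (hF : ∀ j, ContinuousOn (F j) (closure Ω)) :
    ContinuousOn (normalFlux Ω F) (frontier Ω) := by
  refine continuousOn_finsetSum _ fun j _ => ContinuousOn.smul ?_ ((hF j).mono
    frontier_subset_closure)
  exact (by fun_prop : Continuous fun v : Pt n => v j).comp_continuousOn
    (continuousOn_outwardNormal hΩ)

/-- Cutting off at distance about `1 / T` from the boundary and then applying the divergence theorem
for compactly supported fields expresses the integral of `div (χ F)` by an integral over a thin slab
along the boundary. -/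
theorem HasContinuousDiv.integral_eq_slab (hΩ : IsOpen Ω) (hF : HasContinuousDiv Ω F h)
    {p : Pt n} {U : Set (Pt n)} {ρ : Pt n → ℝ} (hρ : IsDefiningFunction Ω p U ρ)
    {θ η : ℝ → ℝ} (hθ : ∀ t, HasDerivAt θ (η t) t) (hη : Continuous η)
    (hθ0 : ∀ t ≤ 1, θ t = 0) (hη0 : ∀ t ≤ 1, η t = 0)
    {χ : Pt n → ℝ} (hχ : ContDiff ℝ 1 χ) (hχc : HasCompactSupport χ) (hχU : tsupport χ ⊆ U)
    {m T : ℝ} (hm : 0 < m) (hT : 0 < T) :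
    Integrable (fun y => (T * η (-(T * (ρ y / m))) * χ y) •
        ∑ j, (m⁻¹ * partialDeriv j ρ y) • F j y) ∧
      Integrable (fun y => θ (-(T * (ρ y / m))) • cutoffDiv χ F h y) ∧
      ∫ y, θ (-(T * (ρ y / m))) • cutoffDiv χ F h y =
        ∫ y, (T * η (-(T * (ρ y / m))) * χ y) • ∑ j, (m⁻¹ * partialDeriv j ρ y) • F j y := by
  have hθ1 : ContDiff ℝ 1 θ := by
    rw [contDiff_one_iff_deriv]
    refine ⟨fun t => (hθ t).differentiableAt, ?_⟩
    rwa [show deriv θ = η from funext fun t => (hθ t).deriv]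
  -- away from `Ω`, the functions `θ` and `η` are evaluated where they vanish
  have hcases : ∀ y, (y ∈ U ∧ y ∈ Ω) ∨
      (∀ᶠ z in 𝓝 y, θ (-(T * (ρ z / m))) = 0 ∧ η (-(T * (ρ z / m))) = 0) ∨
        (χ =ᶠ[𝓝 y] fun _ => 0) := by
    intro y
    by_cases hyχ : y ∈ tsupport χ
    · have hyU := hχU hyχ
      by_cases hyΩ : y ∈ Ω
      · exact Or.inl ⟨hyU, hyΩ⟩
      · refine Or.inr (Or.inl ?_)
        have h1 : 0 ≤ ρ y := not_lt.1 fun hlt => hyΩ ((hρ.mem_iff y hyU).2 hlt)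
        have hc : ContinuousAt (fun z => -(T * (ρ z / m))) y :=
          (((hρ.contDiffAt hyU).continuousAt.div_const m).const_mul T).neg
        have h2 : -(T * (ρ y / m)) < 1 := by
          have : 0 ≤ T * (ρ y / m) := by positivity
          linarith
        filter_upwards [hc.eventually (gt_mem_nhds h2)] with z hz
        exact ⟨hθ0 _ hz.le, hη0 _ hz.le⟩
    · exact Or.inr (Or.inr (notMem_tsupport_iff_eventuallyEq.1 hyχ))
  set G : Pt n → ℝ := fun y => θ (-(T * (ρ y / m))) * χ y with hG
  set Q : Pt n → X := fun y => (T * η (-(T * (ρ y / m))) * χ y) •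
    ∑ j, (m⁻¹ * partialDeriv j ρ y) • F j y with hQ
  have hGc : HasCompactSupport G := hχc.mul_left
  obtain ⟨hGi, hG0⟩ := hF.integral_cutoffDiv_eq_zero hΩ hGc (fun y => by
    rcases hcases y with ⟨hyU, hyΩ⟩ | h0 | h0
    · refine Or.inl ⟨hyΩ, ContDiffAt.mul ?_ hχ.contDiffAt⟩
      exact hθ1.contDiffAt.comp y
        (contDiffAt_const.mul ((hρ.contDiffAt hyU).div_const m)).neg
    · right
      filter_upwards [h0] with z hz
      simp [hG, hz.1]
    · right
      filter_upwards [h0] with z hz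
      simp [hG, hz])
  have hQi : Integrable Q := by
    refine Continuous.integrable_of_hasCompactSupport ?_ (hχc.mul_left.smul_right)
    rw [continuous_iff_continuousAt]
    intro y
    rcases hcases y with ⟨hyU, hyΩ⟩ | h0 | h0
    · have hc : ContinuousAt (fun z => -(T * (ρ z / m))) y :=
        (((hρ.contDiffAt hyU).continuousAt.div_const m).const_mul T).neg
      have hd : ContinuousAt (fderiv ℝ ρ) y :=
        ((hρ.contDiffAt hyU).fderiv_right (m := 0) le_rfl).continuousAt
      refine ((continuousAt_const.mul (hη.continuousAt.comp hc)).mul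
        hχ.continuous.continuousAt).smul (tendsto_finsetSum _ fun j _ => ?_)
      exact (continuousAt_const.mul (hd.clm_apply continuousAt_const)).smul
        ((hF.differentiableOn j).differentiableAt (hΩ.mem_nhds hyΩ)).continuousAt
    · refine (continuousAt_const (y := (0 : X))).congr ?_
      filter_upwards [h0] with z hz
      simp [hQ, hz.2]
    · refine (continuousAt_const (y := (0 : X))).congr ?_
      filter_upwards [h0] with z hz
      simp [hQ, hz]
  have hsplit : ∀ y, θ (-(T * (ρ y / m))) • cutoffDiv χ F h y = cutoffDiv G F h y + Q y := by
    intro y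
    rcases hcases y with ⟨hyU, hyΩ⟩ | h0 | h0
    · have hρd : HasFDerivAt ρ (fderiv ℝ ρ y) y :=
        ((hρ.contDiffAt hyU).differentiableAt one_ne_zero).hasFDerivAt
      have hχd : HasFDerivAt χ (fderiv ℝ χ y) y := (hχ.differentiable one_ne_zero y).hasFDerivAt
      have hGd : HasFDerivAt G (θ (-(T * (ρ y / m))) • fderiv ℝ χ y +
          χ y • η (-(T * (ρ y / m))) • -(T • m⁻¹ • fderiv ℝ ρ y)) y :=
        ((hθ (-(T * (ρ y / m)))).comp_hasFDerivAt y
          (((hρd.mul_const m⁻¹).const_mul T).neg)).mul hχd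
      have hpd : ∀ j, partialDeriv j G y = θ (-(T * (ρ y / m))) * partialDeriv j χ y -
          (T * η (-(T * (ρ y / m))) * χ y) * (m⁻¹ * partialDeriv j ρ y) := fun j => by
        rw [partialDeriv, hGd.fderiv]
        simp [partialDeriv]
        ring
      have hGy : G y = θ (-(T * (ρ y / m))) * χ y := rfl
      simp only [cutoffDiv, hpd, hGy, hQ, sub_smul, Finset.sum_sub_distrib, smul_add,
        Finset.smul_sum, mul_smul]
      abel
    · have h1 : G =ᶠ[𝓝 y] fun _ => 0 := by
        filter_upwards [h0] with z hz
        simp [hG, hz.1]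
      rw [cutoffDiv_eq_zero_of_eventuallyEq h1, h0.self_of_nhds.1]
      simp [hQ, h0.self_of_nhds.2]
    · have h1 : G =ᶠ[𝓝 y] fun _ => 0 := by
        filter_upwards [h0] with z hz
        simp [hG, hz]
      rw [cutoffDiv_eq_zero_of_eventuallyEq h1, cutoffDiv_eq_zero_of_eventuallyEq h0]
      simp [hQ, h0.self_of_nhds]
  simp only [hsplit]
  exact ⟨hQi, hGi.add hQi, by rw [integral_add hGi hQi, hG0, zero_add]⟩

theorem abs_sub_le_of_le_mul {κ x y : ℝ} (hκ : 1 ≤ κ) (hxy : x ≤ κ * y) (hyx : y ≤ κ * x) :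
    |x - y| ≤ (κ - 1) * y := by
  rw [abs_le]
  rcases le_total x y with hle | hle
  · constructor <;> nlinarith [mul_nonneg (sub_nonneg.2 hκ) (sub_nonneg.2 hle)]
  · constructor <;> nlinarith [mul_nonneg (sub_nonneg.2 hκ) (sub_nonneg.2 hle)]

/-- The relative error of the local comparison, for `A = ‖⟪ν(p), F(p)⟫‖`, vanishes as the charts
become isometric. -/
theorem exists_small_distortion (n : ℕ) {A τ : ℝ} (hτ : 0 < τ) :
    ∃ c : ℝ≥0, 0 < c ∧ c < 1 ∧
      (c * ((1 - c)⁻¹ : ℝ≥0) ^ (n + 1) + (((1 - c)⁻¹ : ℝ≥0) ^ (n + 1) - 1) * A) *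
        ((1 - c)⁻¹ : ℝ≥0) ^ (n + 1) + (((1 - c)⁻¹ : ℝ≥0) ^ (n + 1) - 1) * A + c ≤ τ := by
  set q : ℝ → ℝ := fun c => (c * ((1 - c)⁻¹) ^ (n + 1) + (((1 - c)⁻¹) ^ (n + 1) - 1) * A) *
        ((1 - c)⁻¹) ^ (n + 1) + (((1 - c)⁻¹) ^ (n + 1) - 1) * A + c with hq
  have hinv : ContinuousAt (fun c : ℝ => (1 - c)⁻¹) 0 :=
    (continuousAt_const.sub continuousAt_id).inv₀ (by simp)
  have hqc : ContinuousAt q 0 := by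
    have hp := hinv.pow (n + 1)
    have hp1 := (hp.sub (continuousAt_const (y := (1 : ℝ)))).mul (continuousAt_const (y := A))
    exact ((((continuousAt_id.mul hp).add hp1).mul hp).add hp1).add continuousAt_id
  have hq0 : q 0 = 0 := by simp [hq]
  have hev : ∀ᶠ c : ℝ in 𝓝[>] 0, q c < τ := by
    have := hqc.eventually (gt_mem_nhds (hq0.symm ▸ hτ : q 0 < τ))
    exact this.filter_mono nhdsWithin_le_nhds
  obtain ⟨c, hc, hc0, hc1⟩ := (hev.and (Ioo_mem_nhdsGT (zero_lt_one (α := ℝ)))).exists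
  lift c to ℝ≥0 using hc0.le
  refine ⟨c, hc0, by exact_mod_cast hc1, ?_⟩
  rw [NNReal.coe_inv, NNReal.coe_sub (by exact_mod_cast hc1.le)]
  exact hc.le

theorem norm_setIntegral_smul_sub_le [CompleteSpace X] {s : Set (Pt n)}
    {μ : Measure (Pt n)} (hs : MeasurableSet s)
    {w : Pt n → ℝ} {v : Pt n → X} {a : X} {c : ℝ} (hw : IntegrableOn w s μ) (hw0 : ∀ y ∈ s, 0 ≤ w y)
    (hwv : IntegrableOn (fun y => w y • v y) s μ)
    (hv : ∀ y ∈ s, w y ≠ 0 → ‖v y - a‖ ≤ c) :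
    ‖∫ y in s, w y • v y ∂μ - (∫ y in s, w y ∂μ) • a‖ ≤ c * ∫ y in s, w y ∂μ := by
  rw [← integral_smul_const, ← integral_sub hwv (hw.smul_const a), ← integral_const_mul]
  refine norm_integral_le_of_norm_le (hw.const_mul c) ((ae_restrict_iff' hs).2
    (.of_forall fun y hy => ?_))
  rw [← smul_sub, norm_smul, Real.norm_of_nonneg (hw0 y hy), mul_comm]
  by_cases h0 : w y = 0
  · simp [h0]
  · exact mul_le_mul_of_nonneg_right (hv y hy h0) (hw0 y hy)

/-- Multiplying the fields by `χ` with small support around a boundary point, the Gauss-Green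
formula holds up to an error which is small compared with `∫ χ dS`.  The reason is that both sides
are close to `⟪ν(p), F(p)⟫` times the integral of `χ` over the tangent hyperplane. -/
theorem HasContinuousDiv.exists_nhds_frontier [CompleteSpace X] (hΩ : IsNiceDomain Ω)
    (hF : HasContinuousDiv Ω F h) {p : Pt n} (hp : p ∈ frontier Ω) {τ : ℝ} (hτ : 0 < τ) :
    ∃ V : Set (Pt n), IsOpen V ∧ p ∈ V ∧ ∀ χ : Pt n → ℝ, ContDiff ℝ 1 χ → (∀ y, 0 ≤ χ y) →
      HasCompactSupport χ → tsupport χ ⊆ V →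
      ‖(∫ y in Ω, cutoffDiv χ F h y) - ∫ y in frontier Ω, χ y • normalFlux Ω F y ∂μHE[n]‖ ≤
        τ * ∫ y in frontier Ω, χ y ∂μHE[n] := by
  obtain ⟨U, ρ, hρ⟩ := hΩ.c1_boundary p hp
  set m := ‖gradient ρ p‖ with hm
  have hm0 : 0 < m := norm_pos_iff.2 (hρ.gradient_ne_zero p hρ.mem)
  set a := normalFlux Ω F p with ha
  obtain ⟨c, hc0, hc1, hcτ⟩ := exists_small_distortion n (A := ‖a‖) hτ
  obtain ⟨Φ, hpΦ, hΦU, hΦ, hΦ', hΦ0⟩ := hρ.exists_flattening hc0 hc1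
  set K : ℝ≥0 := (1 - c)⁻¹ with hK
  have hK1 : (1 : ℝ) ≤ K := by
    rw [hK, NNReal.coe_inv, NNReal.coe_sub hc1.le]
    have h1 : (c : ℝ) < 1 := by exact_mod_cast hc1
    exact (one_le_inv₀ (by simpa using h1)).2 (by simp)
  set κ : ℝ := (K : ℝ) ^ (n + 1) with hκ
  have hκ1 : 1 ≤ κ := one_le_pow₀ hK1
  have hKκ : (K : ℝ) ^ n ≤ κ := pow_le_pow_right₀ hK1 (Nat.le_succ n)
  have hc0' : (0 : ℝ) < c := hc0
  -- near `p`, both integrands are `c`-close to `a` times `χ`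
  set N : Pt n → X := fun y => ∑ j, (m⁻¹ * partialDeriv j ρ y) • F j y with hN
  have hNp : N p = a := by
    refine Finset.sum_congr rfl fun j _ => ?_
    rw [outwardNormal_eq hΩ.isOpen hρ hρ.mem hp, partialDeriv_eq_gradient
      ((hρ.contDiffAt hρ.mem).differentiableAt one_ne_zero)]
    rfl
  have hpc := frontier_subset_closure hp
  have hNc : ContinuousWithinAt N (closure Ω) p := by
    have hd : ContinuousAt (fderiv ℝ ρ) p :=
        ((hρ.contDiffAt hρ.mem).fderiv_right (m := 0) le_rfl).continuousAt
    refine tendsto_finsetSum _ fun j _ => ?_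
    exact (continuousAt_const.mul (hd.clm_apply continuousAt_const)).continuousWithinAt.smul
      (hF.continuousOn j p hpc)
  have hev1 : ∀ᶠ y in 𝓝 p, y ∈ closure Ω → ‖N y - a‖ ≤ c := by
    rw [← eventually_nhdsWithin_iff]
    have := hNc.eventually (Metric.closedBall_mem_nhds (N p) hc0')
    simpa only [hNp, Metric.mem_closedBall, dist_eq_norm] using this
  have hev2 : ∀ᶠ y in 𝓝 p, y ∈ frontier Ω → ‖normalFlux Ω F y - a‖ ≤ c := by
    rw [← eventually_nhdsWithin_iff]
    have := (continuousOn_normalFlux hΩ hF.continuousOn p hp).eventually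
      (Metric.closedBall_mem_nhds a hc0')
    simpa only [Metric.mem_closedBall, dist_eq_norm] using this
  obtain ⟨V, hV, hVo, hpV⟩ := eventually_nhds_iff.1 (hev1.and hev2)
  refine ⟨V ∩ Φ.source, hVo.inter Φ.open_source, ⟨hpV, hpΦ⟩, fun χ hχ hχ0 hχc hχs => ?_⟩
  have hχV := hχs.trans inter_subset_left
  have hχΦ := hχs.trans inter_subset_right
  have hχU := hχΦ.trans hΦU
  have hmem : ∀ y, χ y ≠ 0 → y ∈ V ∧ y ∈ U := fun y hy =>
    ⟨hχV (subset_tsupport χ hy), hχU (subset_tsupport χ hy)⟩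
  obtain ⟨θ, η, hθ, hη, hη0, hη1, hθz, hθo, hθ0, hθ1, hη2⟩ := exists_cutoff_profile
  obtain ⟨S', J, hJ, hSS', hS'S, hJJ⟩ := hρ.slab_comparison hΩ.isOpen hm0 hΦU hΦ hΦ' hΦ0 hη hη0 hη1
    hη2 hχ.continuous hχ0 hχc hχΦ
  set S := ∫ y in frontier Ω, χ y ∂μHE[n] with hS
  set I := ∫ y in Ω, cutoffDiv χ F h y with hI
  have hS0 : 0 ≤ S := integral_nonneg hχ0
  have hS'0 : 0 ≤ S' := ge_of_tendsto hJ ((eventually_ge_atTop 0).mono fun T hT => (hJJ T hT).1)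
  -- the boundary integral
  have hfm : MeasurableSet (frontier Ω) := isClosed_frontier.measurableSet
  have hB := norm_setIntegral_smul_sub_le (a := a) (c := c) hfm
    (integrableOn_frontier hΩ hχ.continuous.continuousOn) (fun y _ => hχ0 y)
    (integrableOn_frontier hΩ (hχ.continuous.continuousOn.smul
      (continuousOn_normalFlux hΩ hF.continuousOn)))
    (fun y hy hy0 => (hV y (hmem y hy0).1).2 hy)
  -- the slab integrals
  have hslab : ∀ T, 0 < T → ‖(∫ y, θ (-(T * (ρ y / m))) • cutoffDiv χ F h y) - J T • a‖ ≤
      (c * κ + (κ - 1) * ‖a‖) * J T := by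
    intro T hT
    obtain ⟨hQi, -, hQ⟩ := hF.integral_eq_slab hΩ.isOpen hρ hθ hη hθz
      (fun t ht => hη2 t fun h => absurd h.1 (not_lt.2 ht)) hχ hχc hχU hm0 hT
    obtain ⟨hJ0, hJ1, hJ2⟩ := hJJ T hT.le
    set j := ∫ y, T * η (-(T * (ρ y / m))) * χ y with hj
    have hw0 : ∀ y, 0 ≤ T * η (-(T * (ρ y / m))) * χ y := fun y =>
      mul_nonneg (mul_nonneg hT.le (hη0 _)) (hχ0 y)
    have hwi : Integrable fun y => T * η (-(T * (ρ y / m))) * χ y := by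
      refine Continuous.integrable_of_hasCompactSupport ?_ hχc.mul_left
      rw [continuous_iff_continuousAt]
      intro y
      by_cases hy : y ∈ tsupport χ
      · have hc : ContinuousAt (fun z => -(T * (ρ z / m))) y :=
          (((hρ.contDiffAt (hχU hy)).continuousAt.div_const m).const_mul T).neg
        exact (continuousAt_const.mul (hη.continuousAt.comp hc)).mul hχ.continuous.continuousAt
      · refine (continuousAt_const (y := (0 : ℝ))).congr ?_
        filter_upwards [notMem_tsupport_iff_eventuallyEq.1 hy] with z hz
        simp [hz]
    have hest := norm_setIntegral_smul_sub_le (a := a) (c := c) (v := N) MeasurableSet.univ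
      hwi.integrableOn (fun y _ => hw0 y) hQi.integrableOn (fun y _ hy => by
        have hy2 : χ y ≠ 0 := right_ne_zero_of_mul hy
        have hy3 : η (-(T * (ρ y / m))) ≠ 0 := right_ne_zero_of_mul (left_ne_zero_of_mul hy)
        have hy4 : 1 < -(T * (ρ y / m)) := by
          by_contra hcon
          exact hy3 (hη2 _ fun h => hcon h.1)
        have hρy : ρ y < 0 := by
          by_contra! hcon
          have : 0 ≤ T * (ρ y / m) := by positivity
          linarith
        exact (hV y (hmem y hy2).1).1 (subset_closure ((hρ.mem_iff y (hmem y hy2).2).2 hρy)))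
    simp only [setIntegral_univ] at hest
    rw [← hQ, ← hj] at hest
    have habs := abs_sub_le_of_le_mul hκ1 hJ1 hJ2
    calc _ = ‖((∫ y, θ (-(T * (ρ y / m))) • cutoffDiv χ F h y) - j • a) + (j - J T) • a‖ := by
          rw [sub_smul]; congr 1; abel
      _ ≤ c * j + (κ - 1) * J T * ‖a‖ := by
          refine (norm_add_le _ _).trans (add_le_add hest ?_)
          rw [norm_smul, Real.norm_eq_abs]
          gcongr
      _ ≤ _ := by nlinarith [mul_le_mul_of_nonneg_left hJ1 hc0'.le]
  -- removing the cutoff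
  have hHc : ContinuousOn (cutoffDiv χ F h) (closure Ω) := fun y hy =>
    hF.continuousWithinAt_cutoffDiv hχ.contDiffAt hy
  have hHi : IntegrableOn (cutoffDiv χ F h) Ω :=
    (hHc.integrableOn_compact hΩ.isBounded.isCompact_closure).mono_set subset_closure
  have hlim : Tendsto (fun T => ∫ y, θ (-(T * (ρ y / m))) • cutoffDiv χ F h y) atTop (𝓝 I) := by
    rw [hI, ← integral_indicator hΩ.isOpen.measurableSet]
    have hvanish : ∀ T, 0 < T → ∀ y ∉ Ω, θ (-(T * (ρ y / m))) • cutoffDiv χ F h y = 0 := by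
      intro T hT y hy
      by_cases hyχ : y ∈ tsupport χ
      · have h1 : 0 ≤ ρ y := not_lt.1 fun hlt => hy ((hρ.mem_iff y (hχU hyχ)).2 hlt)
        have : 0 ≤ T * (ρ y / m) := by positivity
        rw [hθz _ (by linarith), zero_smul]
      · rw [cutoffDiv_eq_zero_of_notMem hyχ, smul_zero]
    refine tendsto_integral_filter_of_dominated_convergence
      (Ω.indicator fun y => ‖cutoffDiv χ F h y‖) ?_ ?_
      (IntegrableOn.integrable_indicator hHi.norm hΩ.isOpen.measurableSet) ?_
    · filter_upwards [eventually_gt_atTop 0] with T hT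
      obtain ⟨-, hPi, -⟩ := hF.integral_eq_slab hΩ.isOpen hρ hθ hη hθz
        (fun t ht => hη2 t fun h => absurd h.1 (not_lt.2 ht)) hχ hχc hχU hm0 hT
      exact hPi.aestronglyMeasurable
    · filter_upwards [eventually_gt_atTop 0] with T hT
      refine .of_forall fun y => ?_
      by_cases hy : y ∈ Ω
      · rw [indicator_of_mem hy, norm_smul, Real.norm_of_nonneg (hθ0 _)]
        exact mul_le_of_le_one_left (norm_nonneg _) (hθ1 _)
      · rw [hvanish T hT y hy, indicator_of_notMem hy, norm_zero]
    · refine .of_forall fun y => ?_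
      by_cases hy : y ∈ Ω
      · rw [indicator_of_mem hy]
        by_cases hyχ : y ∈ tsupport χ
        · have hneg : 0 < -(ρ y / m) := by
            have h1 := (hρ.mem_iff y (hχU hyχ)).1 hy
            rw [neg_pos]
            exact div_neg_of_neg_of_pos h1 hm0
          refine tendsto_const_nhds.congr' ?_
          filter_upwards [(tendsto_id.atTop_mul_const hneg).eventually_ge_atTop 2] with T hT
          rw [hθo _ (by simpa using hT), one_smul]
        · simp [cutoffDiv_eq_zero_of_notMem hyχ]
      · rw [indicator_of_notMem hy]
        refine tendsto_const_nhds.congr' ?_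
        filter_upwards [eventually_gt_atTop 0] with T hT using (hvanish T hT y hy).symm
  have hIest : ‖I - S' • a‖ ≤ (c * κ + (κ - 1) * ‖a‖) * S' :=
    le_of_tendsto_of_tendsto (hlim.sub (hJ.smul_const a)).norm (hJ.const_mul _)
      ((eventually_gt_atTop 0).mono hslab)
  have hSκ : S ≤ κ * S' := hSS'.trans (mul_le_mul_of_nonneg_right hKκ hS'0)
  have hS'κ : S' ≤ κ * S := hS'S.trans (mul_le_mul_of_nonneg_right hKκ hS0)
  have hSd := abs_sub_le_of_le_mul hκ1 hS'κ hSκ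
  have hcoef : 0 ≤ c * κ + (κ - 1) * ‖a‖ := by
    have := sub_nonneg.2 hκ1
    positivity
  set B := ∫ y in frontier Ω, χ y • normalFlux Ω F y ∂μHE[n] with hBdef
  calc ‖I - B‖ = ‖(I - S' • a) + ((S' - S) • a - (B - S • a))‖ := by
        rw [sub_smul]; congr 1; abel
    _ ≤ (c * κ + (κ - 1) * ‖a‖) * S' + ((κ - 1) * S * ‖a‖ + c * S) := by
        refine (norm_add_le _ _).trans (add_le_add hIest ((norm_sub_le _ _).trans
          (add_le_add ?_ hB)))
        rw [norm_smul, Real.norm_eq_abs]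
        gcongr
    _ ≤ ((c * κ + (κ - 1) * ‖a‖) * κ + (κ - 1) * ‖a‖ + c) * S := by
        nlinarith [mul_le_mul_of_nonneg_left hS'κ hcoef]
    _ ≤ τ * S := mul_le_mul_of_nonneg_right hcτ hS0

/-! ### The Gauss-Green formula on a domain -/

theorem HasContinuousDiv.integral_cutoffDiv_of_tsupport_subset (hΩ : IsOpen Ω)
    (hF : HasContinuousDiv Ω F h) {χ : Pt n → ℝ} (hχ : ContDiff ℝ 1 χ) (hχc : HasCompactSupport χ)
    (hχΩ : tsupport χ ⊆ Ω) : ∫ y in Ω, cutoffDiv χ F h y = 0 := by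
  rw [setIntegral_eq_integral_of_forall_compl_eq_zero fun y hy =>
    cutoffDiv_eq_zero_of_notMem fun hm => hy (hχΩ hm)]
  refine (hF.integral_cutoffDiv_eq_zero hΩ hχc fun y => ?_).2
  by_cases hy : y ∈ tsupport χ
  · exact Or.inl ⟨hχΩ hy, hχ.contDiffAt⟩
  · exact Or.inr (notMem_tsupport_iff_eventuallyEq.1 hy)

/-- The **Gauss-Green formula** on a bounded domain with `C¹` boundary, for fields that are
continuous up to the boundary, differentiable inside, and have a divergence that extends
continuously.  The local estimates are summed with a partition of unity; the total error is at most
`τ` times the area of the boundary, for every `τ > 0`. -/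
theorem HasContinuousDiv.integral_eq_integral_normalFlux [CompleteSpace X] (hΩ : IsNiceDomain Ω)
    (hF : HasContinuousDiv Ω F h) :
    ∫ y in Ω, h y = ∫ y in frontier Ω, normalFlux Ω F y ∂μHE[n] := by
  have hcl : IsCompact (closure Ω) := hΩ.isBounded.isCompact_closure
  have hfm : MeasurableSet (frontier Ω) := isClosed_frontier.measurableSet
  set I := ∫ y in Ω, h y with hI
  set B := ∫ y in frontier Ω, normalFlux Ω F y ∂μHE[n] with hB
  set M := (μHE[n] : Measure (Pt n)).real (frontier Ω) with hM
  have key : ∀ τ : ℝ, 0 < τ → ‖I - B‖ ≤ τ * M := by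
    intro τ hτ
    have hloc : ∀ p ∈ closure Ω, ∃ V : Set (Pt n), IsOpen V ∧ p ∈ V ∧ Bornology.IsBounded V ∧
        ∀ χ : Pt n → ℝ, ContDiff ℝ 1 χ → (∀ y, 0 ≤ χ y) → HasCompactSupport χ → tsupport χ ⊆ V →
        ‖(∫ y in Ω, cutoffDiv χ F h y) - ∫ y in frontier Ω, χ y • normalFlux Ω F y ∂μHE[n]‖ ≤
          τ * ∫ y in frontier Ω, χ y ∂μHE[n] := by
      intro p hp
      by_cases hpΩ : p ∈ Ω
      · refine ⟨Ω, hΩ.isOpen, hpΩ, hΩ.isBounded, fun χ hχ hχ0 hχc hχΩ => ?_⟩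
        have hz : ∀ y ∈ frontier Ω, χ y = 0 := fun y hy =>
          image_eq_zero_of_notMem_tsupport fun hm => by
            rw [hΩ.isOpen.frontier_eq] at hy
            exact hy.2 (hχΩ hm)
        rw [hF.integral_cutoffDiv_of_tsupport_subset hΩ.isOpen hχ hχc hχΩ,
          setIntegral_congr_fun hfm hz,
          setIntegral_congr_fun (g := fun _ => (0 : X)) hfm fun y hy => by simp [hz y hy]]
        simp
      · have hpf : p ∈ frontier Ω := by
          rw [hΩ.isOpen.frontier_eq]
          exact ⟨hp, hpΩ⟩
        obtain ⟨V, hVo, hpV, hV⟩ := hF.exists_nhds_frontier hΩ hpf hτ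
        exact ⟨V ∩ Metric.ball p 1, hVo.inter Metric.isOpen_ball,
          ⟨hpV, Metric.mem_ball_self one_pos⟩, Metric.isBounded_ball.subset inter_subset_right,
          fun χ h1 h2 h3 h4 => hV χ h1 h2 h3 (h4.trans inter_subset_left)⟩
    choose! V hVo hpV hVb hV using hloc
    obtain ⟨t, ht, htV⟩ := hcl.elim_nhds_subcover V fun p hp => (hVo p hp).mem_nhds (hpV p hp)
    obtain ⟨f, hf⟩ := SmoothPartitionOfUnity.exists_isSubordinate (modelWithCornersSelf ℝ (Pt n))
      isClosed_closure (fun i : t => V i) (fun i => hVo _ (ht _ i.2)) (by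
        simpa [iUnion_subtype] using htV)
    have hfs : ∀ i, ContDiff ℝ 1 (f i) := fun i =>
      (contMDiff_iff_contDiff.1 (f i).contMDiff).of_le (by exact_mod_cast le_top)
    have hf0 : ∀ i y, 0 ≤ f i y := fun i y => f.nonneg i y
    have hfc : ∀ i, HasCompactSupport (f i) := fun i =>
      Metric.isCompact_of_isClosed_isBounded (isClosed_tsupport _)
        ((hVb _ (ht _ i.2)).subset (hf i))
    have hsum : ∀ y ∈ closure Ω, ∑ i, f i y = 1 := fun y hy => by
      rw [← finsum_eq_sum_of_fintype]
      exact f.sum_eq_one hy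
    have hdsum : ∀ y ∈ Ω, ∑ i, cutoffDiv (f i) F h y = h y := by
      intro y hy
      -- the cutoffs sum to `1` on the open set `Ω`, so their derivatives sum to `0` there
      have hev : (fun z => ∑ i, f i z) =ᶠ[𝓝 y] fun _ => 1 := by
        filter_upwards [hΩ.isOpen.mem_nhds hy] with z hz using hsum z (subset_closure hz)
      have hpd : ∀ j, ∑ i, partialDeriv j (f i) y = 0 := fun j => by
        have h1 : fderiv ℝ (fun z => ∑ i, f i z) y = ∑ i, fderiv ℝ (f i) y :=
          fderiv_fun_sum fun i _ => (hfs i).differentiable one_ne_zero y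
        have h2 := congrArg (fun L => L (EuclideanSpace.single j 1)) (h1.symm.trans hev.fderiv_eq)
        simpa [partialDeriv] using h2
      simp only [cutoffDiv, Finset.sum_add_distrib]
      rw [Finset.sum_comm, ← Finset.sum_smul, hsum y (subset_closure hy), one_smul]
      simp only [← Finset.sum_smul, hpd]
      simp
    have hIsum : I = ∑ i, ∫ y in Ω, cutoffDiv (f i) F h y := by
      rw [← integral_finsetSum]
      · exact setIntegral_congr_fun hΩ.isOpen.measurableSet fun y hy => (hdsum y hy).symm
      · intro i _
        have : ContinuousOn (cutoffDiv (f i) F h) (closure Ω) := fun y hy =>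
          hF.continuousWithinAt_cutoffDiv (hfs i).contDiffAt hy
        exact (this.integrableOn_compact hcl).mono_set subset_closure
    have hBsum : B = ∑ i, ∫ y in frontier Ω, f i y • normalFlux Ω F y ∂μHE[n] := by
      rw [← integral_finsetSum]
      · refine setIntegral_congr_fun hfm fun y hy => ?_
        simp only [← Finset.sum_smul, hsum y (frontier_subset_closure hy), one_smul]
      · exact fun i _ => integrableOn_frontier hΩ ((hfs i).continuous.continuousOn.smul
          (continuousOn_normalFlux hΩ hF.continuousOn))
    have hMsum : M = ∑ i, ∫ y in frontier Ω, f i y ∂μHE[n] := by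
      rw [← integral_finsetSum]
      · rw [setIntegral_congr_fun (g := fun _ => (1 : ℝ)) hfm fun y hy =>
          hsum y (frontier_subset_closure hy)]
        simp [hM]
      · exact fun i _ => integrableOn_frontier hΩ (hfs i).continuous.continuousOn
    rw [hIsum, hBsum, hMsum, ← Finset.sum_sub_distrib, Finset.mul_sum]
    exact norm_sum_le_of_le _ fun i _ => hV _ (ht _ i.2) (f i) (hfs i) (hf0 i) (hfc i) (hf i)
  have hlim : Tendsto (fun τ : ℝ => τ * M) (𝓝[>] 0) (𝓝 0) := by
    have : Continuous fun τ : ℝ => τ * M := by fun_prop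
    simpa using (this.tendsto 0).mono_left nhdsWithin_le_nhds
  have hle : ‖I - B‖ ≤ 0 := ge_of_tendsto hlim (by
    filter_upwards [self_mem_nhdsWithin] with τ hτ using key τ hτ)
  exact sub_eq_zero.1 (norm_le_zero_iff.1 hle)

end GaussGreen

/-! ### Clifford algebra identities -/

theorem star_e {n : ℕ} (j : Fin n) : star (e j : Cl n) = -e j := by
  rw [e, CliffordAlgebra.star_ι]

theorem star_unit_mul_unit {n : ℕ} {s : ℝ} (hs : s = 1 ∨ s = -1) (j : Fin (n + 1)) :
    star (unit s j : Cl n) * unit s j = 1 := by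
  have hs2 : s * s = 1 := by rcases hs with rfl | rfl <;> norm_num
  refine Fin.cases ?_ (fun i => ?_) j
  · simp [unit]
  · simp only [unit, Fin.cases_succ]
    rw [CliffordAlgebra.star_smul, star_e, smul_neg, neg_mul, smul_mul_smul_comm, e_mul_self, hs2]
    simp

theorem star_paravector {n : ℕ} (s : ℝ) (z : Pt n) :
    star (paravector s z : Cl n) = ∑ j, z j • star (unit s j : Cl n) := by
  simp only [paravector, star_sum, CliffordAlgebra.star_smul]

/-- The conjugate of a paravector is its inverse up to the squared norm. -/
theorem star_paravector_mul_self {n : ℕ} {s : ℝ} (hs : s = 1 ∨ s = -1) (z : Pt n) :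
    star (paravector s z : Cl n) * paravector s z = algebraMap ℝ (Cl n) (‖z‖ ^ 2) := by
  have hs2 : s * s = 1 := by rcases hs with rfl | rfl <;> norm_num
  set v : Fin n → ℝ := fun i => z i.succ with hv
  have hι : CliffordAlgebra.ι (cliffordForm n) v = ∑ i, z i.succ • (e i : Cl n) := by
    conv_lhs => rw [pi_eq_sum_univ v]
    rw [map_sum]
    refine Finset.sum_congr rfl fun j _ => ?_
    rw [map_smul, e]
    congr 2
    ext i
    simp [Pi.single_apply, eq_comm]
  have hp : (paravector s z : Cl n) = algebraMap ℝ (Cl n) (z 0) +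
      s • CliffordAlgebra.ι (cliffordForm n) v := by
    rw [hι, paravector, Fin.sum_univ_succ, Finset.smul_sum, Algebra.algebraMap_eq_smul_one]
    congr 1
    refine Finset.sum_congr rfl fun i _ => ?_
    simp only [unit, Fin.cases_succ]
    rw [smul_comm]
  have hstar : star (paravector s z : Cl n) = algebraMap ℝ (Cl n) (z 0) -
      s • CliffordAlgebra.ι (cliffordForm n) v := by
    rw [hp, star_add, CliffordAlgebra.star_algebraMap, CliffordAlgebra.star_smul,
      CliffordAlgebra.star_ι, smul_neg, sub_eq_add_neg]
  have hq : cliffordForm n v = -∑ i : Fin n, z i.succ ^ 2 := by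
    simp [cliffordForm, QuadraticMap.weightedSumSquares_apply, hv, pow_two]
  have hcomm := Algebra.commutes (z 0) (s • CliffordAlgebra.ι (cliffordForm n) v)
  have hsq : s • CliffordAlgebra.ι (cliffordForm n) v * s • CliffordAlgebra.ι (cliffordForm n) v =
      -algebraMap ℝ (Cl n) (∑ i : Fin n, z i.succ ^ 2) := by
    rw [smul_mul_smul_comm, CliffordAlgebra.ι_sq_scalar, hq, hs2, one_smul, map_neg]
  rw [hstar, hp, EuclideanSpace.norm_sq_eq, Fin.sum_univ_succ, sub_mul, mul_add, mul_add, hsq,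
    hcomm, ← map_mul]
  simp only [Real.norm_eq_abs, sq_abs]
  rw [map_add, ← pow_two]
  abel

/-- The conjugate paravector, as a continuous linear map. -/
def conjParavector {n : ℕ} (s : ℝ) : Pt n →L[ℝ] Cl n :=
  ∑ j, (EuclideanSpace.proj j : Pt n →L[ℝ] ℝ).smulRight (star (unit s j : Cl n))

theorem conjParavector_apply {n : ℕ} (s : ℝ) (z : Pt n) :
    conjParavector s z = star (paravector s z : Cl n) := by
  rw [star_paravector]
  simp [conjParavector]

theorem continuous_paravector {n : ℕ} (s : ℝ) :
    Continuous (paravector s : Pt n → Cl n) := by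
  unfold paravector
  fun_prop

/-! ### The regularized Cauchy kernel -/

/-- The constant of the Cauchy kernel, the inverse of the area of the unit sphere. -/
def cauchyConst (n : ℕ) : ℝ :=
  Real.Gamma (((n : ℝ) + 1) / 2) / (2 * Real.pi ^ (((n : ℝ) + 1) / 2))

theorem cauchyConst_pos (n : ℕ) : 0 < cauchyConst n := by
  have : 0 < Real.Gamma (((n : ℝ) + 1) / 2) := Real.Gamma_pos_of_pos (by positivity)
  unfold cauchyConst
  positivity

/-- The smooth kernel `c z̄ / (|z|² + ε²) ^ ((n + 1) / 2)`, equal to the Cauchy kernel for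
`ε = 0`. -/
def regKernel {n : ℕ} (s ε : ℝ) (z : Pt n) : Cl n :=
  (cauchyConst n * (‖z‖ ^ 2 + ε ^ 2) ^ (-(((n : ℝ) + 1) / 2))) • conjParavector s z

theorem hasFDerivAt_normSq_add_rpow {n : ℕ} {ε : ℝ} (hε : ε ≠ 0) (a : ℝ) (z : Pt n) :
    HasFDerivAt (fun z : Pt n => (‖z‖ ^ 2 + ε ^ 2) ^ a)
      ((a * (‖z‖ ^ 2 + ε ^ 2) ^ (a - 1)) • (2 • innerSL ℝ z)) z := by
  have hpos : 0 < ‖z‖ ^ 2 + ε ^ 2 := by positivity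
  have h1 : HasFDerivAt (fun z : Pt n => ‖z‖ ^ 2 + ε ^ 2) (2 • innerSL ℝ z) z :=
    (hasStrictFDerivAt_norm_sq z).hasFDerivAt.add_const _
  exact (Real.hasDerivAt_rpow_const (Or.inl hpos.ne')).comp_hasFDerivAt z h1

theorem hasFDerivAt_regKernel {n : ℕ} (s : ℝ) {ε : ℝ} (hε : ε ≠ 0) (z : Pt n) :
    HasFDerivAt (regKernel s ε : Pt n → Cl n)
      ((cauchyConst n * (‖z‖ ^ 2 + ε ^ 2) ^ (-(((n : ℝ) + 1) / 2))) • conjParavector s +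
        (cauchyConst n • ((-(((n : ℝ) + 1) / 2) * (‖z‖ ^ 2 + ε ^ 2) ^ (-(((n : ℝ) + 1) / 2) - 1)) •
          (2 • innerSL ℝ z))).smulRight (conjParavector s z)) z :=
  ((hasFDerivAt_normSq_add_rpow hε _ z).const_mul (cauchyConst n)).smul
    (conjParavector s).hasFDerivAt

/-- The Cauchy-Riemann operator, applied from the right, takes the regularized kernel to an
approximation of the Dirac measure. -/
theorem sum_partialDeriv_regKernel_mul_unit {n : ℕ} {s : ℝ} (hs : s = 1 ∨ s = -1) {ε : ℝ}
    (hε : ε ≠ 0) (z : Pt n) :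
    ∑ j, partialDeriv j (regKernel s ε) z * (unit s j : Cl n) =
      algebraMap ℝ (Cl n) (cauchyConst n * (n + 1) * ε ^ 2 *
        (‖z‖ ^ 2 + ε ^ 2) ^ (-(((n : ℝ) + 1) / 2) - 1)) := by
  have hpos : 0 < ‖z‖ ^ 2 + ε ^ 2 := by positivity
  set a : ℝ := -(((n : ℝ) + 1) / 2) with ha
  set r : ℝ := ‖z‖ ^ 2 + ε ^ 2 with hr
  have hconj : ∀ j : Fin (n + 1), conjParavector s (EuclideanSpace.single j 1) =
      star (unit s j : Cl n) := fun j => by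
    simp [conjParavector_apply, star_paravector]
  have hterm : ∀ j, partialDeriv j (regKernel s ε) z * (unit s j : Cl n) =
      (cauchyConst n * r ^ a) • (1 : Cl n) + (cauchyConst n * (2 * a) * r ^ (a - 1)) •
        (star (paravector s z : Cl n) * z j • unit s j) := by
    intro j
    have hlin : (cauchyConst n • ((a * r ^ (a - 1)) • (2 • innerSL ℝ z)))
        (EuclideanSpace.single j 1) = cauchyConst n * (2 * a) * r ^ (a - 1) * z j := by
      simp [EuclideanSpace.inner_single_right]
      ring
    rw [partialDeriv, (hasFDerivAt_regKernel s hε z).fderiv, add_apply, smul_apply,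
      ContinuousLinearMap.smulRight_apply, hlin, hconj, conjParavector_apply, add_mul,
      smul_mul_assoc, smul_mul_assoc, star_unit_mul_unit hs, mul_smul_comm, smul_smul]
  simp only [hterm]
  rw [Finset.sum_add_distrib, ← Finset.smul_sum, ← Finset.smul_sum, ← Finset.mul_sum,
    show ∑ j, z j • (unit s j : Cl n) = paravector s z from rfl, star_paravector_mul_self hs]
  have hra : r ^ a = r * r ^ (a - 1) := by
    rw [← Real.rpow_one_add' hpos.le (by simp [ha]; positivity)]
    congr 1
    ring
  rw [hra]
  simp only [Finset.sum_const, Finset.card_univ, Fintype.card_fin, Algebra.algebraMap_eq_smul_one,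
    smul_smul, ← add_smul, ← Nat.cast_smul_eq_nsmul ℝ]
  congr 1
  push_cast
  rw [ha, hr]
  ring

/-- The profile of the approximate identity obtained from the regularized kernel. -/
def poissonProfile (n : ℕ) (z : Pt n) : ℝ :=
  cauchyConst n * (n + 1) * (‖z‖ ^ 2 + 1) ^ (-(((n : ℝ) + 1) / 2) - 1)

theorem poissonProfile_nonneg (n : ℕ) (z : Pt n) : 0 ≤ poissonProfile n z := by
  have := cauchyConst_pos n
  unfold poissonProfile
  positivity

theorem poissonProfile_scale {n : ℕ} {T : ℝ} (hT : 0 < T) (z : Pt n) :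
    T ^ (n + 1) * poissonProfile n (T • z) = cauchyConst n * (n + 1) * T⁻¹ ^ 2 *
      (‖z‖ ^ 2 + T⁻¹ ^ 2) ^ (-(((n : ℝ) + 1) / 2) - 1) := by
  have h1 : ‖T • z‖ ^ 2 + 1 = T ^ 2 * (‖z‖ ^ 2 + T⁻¹ ^ 2) := by
    rw [norm_smul, Real.norm_of_nonneg hT.le]
    field_simp
  have h2 : (T ^ 2) ^ (-(((n : ℝ) + 1) / 2) - 1) = (T ^ (n + 3))⁻¹ := by
    rw [← Real.rpow_natCast T 2, ← Real.rpow_mul hT.le, ← Real.rpow_natCast T (n + 3),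
      ← Real.rpow_neg hT.le]
    congr 1
    push_cast
    ring
  rw [poissonProfile, h1, Real.mul_rpow (by positivity) (by positivity), h2]
  field_simp
  ring

theorem integral_radial_poisson (n : ℕ) :
    ∫ y in Ioi (0 : ℝ), y ^ n * (((n : ℝ) + 1) * (y ^ 2 + 1) ^ (-(((n : ℝ) + 1) / 2) - 1)) = 1 := by
  set a : ℝ := -(((n : ℝ) + 1) / 2) with ha
  have hd : ∀ y : ℝ, HasDerivAt (fun y : ℝ => y ^ (n + 1) * (y ^ 2 + 1) ^ a)
      (y ^ n * (((n : ℝ) + 1) * (y ^ 2 + 1) ^ (a - 1))) y := by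
    intro y
    have hpos : 0 < y ^ 2 + 1 := by positivity
    have h1 : HasDerivAt (fun y : ℝ => y ^ 2 + 1) (2 * y) y := by
      simpa using (hasDerivAt_pow 2 y).add_const 1
    have h2 := (hasDerivAt_pow (n + 1) y).mul (h1.rpow_const (p := a) (Or.inl hpos.ne'))
    refine h2.congr_deriv ?_
    have hra : (y ^ 2 + 1) ^ a = (y ^ 2 + 1) * (y ^ 2 + 1) ^ (a - 1) := by
      rw [← Real.rpow_one_add' hpos.le (by simp [ha]; positivity)]
      congr 1
      ring
    rw [hra, ha]
    push_cast
    ring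
  have hlim : Tendsto (fun y : ℝ => y ^ (n + 1) * (y ^ 2 + 1) ^ a) atTop (𝓝 1) := by
    have h1 : Tendsto (fun y : ℝ => (1 + (y ^ 2)⁻¹) ^ a) atTop (𝓝 1) := by
      have h2 : Tendsto (fun y : ℝ => 1 + (y ^ 2)⁻¹) atTop (𝓝 (1 + 0)) :=
        tendsto_const_nhds.add (tendsto_inv_atTop_zero.comp (tendsto_pow_atTop two_ne_zero))
      rw [add_zero] at h2
      simpa using h2.rpow_const (p := a) (Or.inl one_ne_zero)
    refine h1.congr' ?_
    filter_upwards [eventually_gt_atTop 0] with y hy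
    have h3 : y ^ (n + 1) = (y ^ 2) ^ (-a) := by
      rw [← Real.rpow_natCast y 2, ← Real.rpow_mul hy.le, ← Real.rpow_natCast y (n + 1), ha]
      congr 1
      push_cast
      ring
    have h4 : 1 + (y ^ 2)⁻¹ = (y ^ 2)⁻¹ * (y ^ 2 + 1) := by field_simp
    have hy2 : 0 ≤ y ^ 2 := by positivity
    rw [h3, h4, Real.mul_rpow (by positivity) (by positivity), Real.inv_rpow hy2,
      Real.rpow_neg hy2 a]
  have := integral_Ioi_of_hasDerivAt_of_nonneg' (a := 0) (fun y _ => hd y)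
    (fun y (hy : 0 < y) => by positivity) hlim
  rw [this]
  simp

theorem integral_poissonProfile (n : ℕ) : ∫ z, poissonProfile n z = 1 := by
  have h := integral_fun_norm_addHaar (volume : Measure (Pt n))
    (fun y => cauchyConst n * (((n : ℝ) + 1) * (y ^ 2 + 1) ^ (-(((n : ℝ) + 1) / 2) - 1)))
  have hdim : Module.finrank ℝ (Pt n) = n + 1 := by simp
  have hpoisson : ∀ z : Pt n, poissonProfile n z =
      cauchyConst n * (((n : ℝ) + 1) * (‖z‖ ^ 2 + 1) ^ (-(((n : ℝ) + 1) / 2) - 1)) := fun z => by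
    rw [poissonProfile, mul_assoc]
  simp only [hpoisson]
  rw [h, hdim]
  have h1 : ∫ y in Ioi (0 : ℝ), y ^ (n + 1 - 1) •
      (cauchyConst n * (((n : ℝ) + 1) * (y ^ 2 + 1) ^ (-(((n : ℝ) + 1) / 2) - 1))) =
        cauchyConst n := by
    simp only [Nat.add_sub_cancel, smul_eq_mul, mul_left_comm _ (cauchyConst n)]
    rw [integral_const_mul, integral_radial_poisson, mul_one]
  have hball : (volume : Measure (Pt n)).real (Metric.ball 0 1) =
      Real.pi ^ (((n : ℝ) + 1) / 2) / ((((n : ℝ) + 1) / 2) * Real.Gamma (((n : ℝ) + 1) / 2)) := by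
    rw [Measure.real, EuclideanSpace.volume_ball]
    simp only [ENNReal.ofReal_one, one_pow, one_mul, Fintype.card_fin]
    have hg : 0 < Real.Gamma (((n : ℝ) + 1) / 2 + 1) := Real.Gamma_pos_of_pos (by positivity)
    push_cast
    rw [ENNReal.toReal_ofReal (by positivity), Real.Gamma_add_one (by positivity),
      Real.sqrt_eq_rpow, ← Real.rpow_natCast, ← Real.rpow_mul Real.pi_pos.le]
    congr 2
    push_cast
    ring
  have hg : Real.Gamma (((n : ℝ) + 1) / 2) ≠ 0 := (Real.Gamma_pos_of_pos (by positivity)).ne'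
  have hpi : Real.pi ^ (((n : ℝ) + 1) / 2) ≠ 0 :=
    (Real.rpow_pos_of_pos Real.pi_pos _).ne'
  rw [h1, hball, cauchyConst]
  simp only [nsmul_eq_mul, smul_eq_mul]
  push_cast
  field_simp

theorem tendsto_norm_pow_mul_poissonProfile (n : ℕ) :
    Tendsto (fun z : Pt n => ‖z‖ ^ Module.finrank ℝ (Pt n) * poissonProfile n z)
      (Bornology.cobounded (Pt n)) (𝓝 0) := by
  have hdim : Module.finrank ℝ (Pt n) = n + 1 := by simp
  rw [hdim]
  have hC := cauchyConst_pos n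
  have h1 : Tendsto (fun z : Pt n => cauchyConst n * (n + 1) * (‖z‖ ^ 2)⁻¹)
      (Bornology.cobounded (Pt n)) (𝓝 0) := by
    have := (tendsto_inv_atTop_zero.comp ((tendsto_pow_atTop two_ne_zero).comp
      (tendsto_norm_cobounded_atTop (E := Pt n)))).const_mul (cauchyConst n * (n + 1))
    simpa using this
  refine squeeze_zero' (.of_forall fun z => mul_nonneg (by positivity) (poissonProfile_nonneg n z))
    ?_ h1
  filter_upwards [tendsto_norm_cobounded_atTop.eventually_gt_atTop 0] with z hz
  have h2 : (‖z‖ ^ 2 + 1) ^ (-(((n : ℝ) + 1) / 2) - 1) ≤ (‖z‖ ^ (n + 3))⁻¹ := by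
    have h3 : (‖z‖ ^ 2) ^ (-(((n : ℝ) + 1) / 2) - 1) = (‖z‖ ^ (n + 3))⁻¹ := by
      rw [← Real.rpow_natCast ‖z‖ 2, ← Real.rpow_mul hz.le, ← Real.rpow_natCast ‖z‖ (n + 3),
        ← Real.rpow_neg hz.le]
      congr 1
      push_cast
      ring
    rw [← h3]
    refine Real.rpow_le_rpow_of_nonpos (by positivity) (by linarith) ?_
    have : (0 : ℝ) ≤ ((n : ℝ) + 1) / 2 := by positivity
    linarith
  calc ‖z‖ ^ (n + 1) * poissonProfile n z
      ≤ ‖z‖ ^ (n + 1) * (cauchyConst n * (n + 1) * (‖z‖ ^ (n + 3))⁻¹) := by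
        unfold poissonProfile
        gcongr
    _ = _ := by
        field_simp
        ring

/-- The regularized kernel is the Cauchy kernel times a factor in `[0, 1]`. -/
theorem regKernel_eq_smul_cauchyKernel {n : ℕ} (s ε : ℝ) {z : Pt n} (hz : z ≠ 0) :
    (regKernel s ε z : Cl n) = (‖z‖ ^ (n + 1) * (‖z‖ ^ 2 + ε ^ 2) ^ (-(((n : ℝ) + 1) / 2))) •
      cauchyKernel s z := by
  have hz' : ‖z‖ ^ (n + 1) ≠ 0 := pow_ne_zero _ (norm_ne_zero_iff.2 hz)
  rw [regKernel, cauchyKernel, conjParavector_apply, smul_smul, ← cauchyConst]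
  congr 1
  field_simp

theorem norm_pow_eq_rpow {n : ℕ} (z : Pt n) :
    (‖z‖ ^ 2) ^ (-(((n : ℝ) + 1) / 2)) = (‖z‖ ^ (n + 1))⁻¹ := by
  rw [← Real.rpow_natCast ‖z‖ 2, ← Real.rpow_mul (norm_nonneg _), ← Real.rpow_natCast ‖z‖ (n + 1),
    ← Real.rpow_neg (norm_nonneg _)]
  congr 1
  push_cast
  ring

theorem regKernel_factor_le_one {n : ℕ} (ε : ℝ) {z : Pt n} (hz : z ≠ 0) :
    ‖z‖ ^ (n + 1) * (‖z‖ ^ 2 + ε ^ 2) ^ (-(((n : ℝ) + 1) / 2)) ≤ 1 := by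
  have hz' : 0 < ‖z‖ := norm_pos_iff.2 hz
  have h1 : (‖z‖ ^ 2 + ε ^ 2) ^ (-(((n : ℝ) + 1) / 2)) ≤ (‖z‖ ^ 2) ^ (-(((n : ℝ) + 1) / 2)) := by
    refine Real.rpow_le_rpow_of_nonpos (by positivity) (by nlinarith [sq_nonneg ε]) ?_
    have : (0 : ℝ) ≤ ((n : ℝ) + 1) / 2 := by positivity
    linarith
  calc _ ≤ ‖z‖ ^ (n + 1) * (‖z‖ ^ 2) ^ (-(((n : ℝ) + 1) / 2)) := by gcongr
    _ = 1 := by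
      rw [norm_pow_eq_rpow z]
      field_simp

theorem tendsto_regKernel_factor {n : ℕ} {z : Pt n} (hz : z ≠ 0) :
    Tendsto (fun ε : ℝ => ‖z‖ ^ (n + 1) * (‖z‖ ^ 2 + ε ^ 2) ^ (-(((n : ℝ) + 1) / 2)))
      (𝓝 0) (𝓝 1) := by
  have hz' : 0 < ‖z‖ := norm_pos_iff.2 hz
  have h1 : Tendsto (fun ε : ℝ => ‖z‖ ^ 2 + ε ^ 2) (𝓝 0) (𝓝 (‖z‖ ^ 2)) := by
    have : Continuous fun ε : ℝ => ‖z‖ ^ 2 + ε ^ 2 := by fun_prop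
    simpa using this.tendsto 0
  have h2 := (h1.rpow_const (p := -(((n : ℝ) + 1) / 2)) (Or.inl (by positivity))).const_mul
    (‖z‖ ^ (n + 1))
  rwa [norm_pow_eq_rpow z, mul_inv_cancel₀ (by positivity)] at h2

/-! ### The Cauchy formula for solutions of the Cauchy-Riemann system -/

theorem sum_smul_mul_unit {n : ℕ} {V : Type*} [AddCommGroup V] [Module ℝ V]
    [Module (Cl n) V] [IsScalarTower ℝ (Cl n) V] (s : ℝ) (a : Cl n) (ν : Pt n) (v : V) :
    ∑ j, ν j • (a * unit s j) • v = (a * paravector s ν) • v := by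
  rw [paravector, Finset.mul_sum, Finset.sum_smul]
  refine Finset.sum_congr rfl fun j _ => ?_
  rw [mul_smul_comm, smul_assoc]

section Monogenic

variable {n : ℕ} {V : Type*} [NormedAddCommGroup V] [NormedSpace ℝ V]
  [Module (Cl n) V] [IsScalarTower ℝ (Cl n) V] [ContinuousConstSMul (Cl n) V]

/-- The action of the Clifford algebra, as a continuous bilinear map.  It is continuous in the
first variable because the Clifford algebra has finite dimension. -/
def cliffordAction (n : ℕ) (V : Type*) [NormedAddCommGroup V] [NormedSpace ℝ V]
    [Module (Cl n) V] [IsScalarTower ℝ (Cl n) V] [ContinuousConstSMul (Cl n) V] :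
    Cl n →L[ℝ] V →L[ℝ] V :=
  haveI : SMulCommClass ℝ (Cl n) V := IsScalarTower.to_smulCommClass
  LinearMap.toContinuousLinearMap
    { toFun := fun a =>
        { toFun := fun v => a • v
          map_add' := smul_add a
          map_smul' := fun r v => (smul_comm r a v).symm
          cont := continuous_const_smul a }
      map_add' := fun a b => by ext v; exact add_smul a b v
      map_smul' := fun r a => by ext v; exact smul_assoc r a v }

@[simp]
theorem cliffordAction_apply (n : ℕ) (V : Type*) [NormedAddCommGroup V] [NormedSpace ℝ V]
    [Module (Cl n) V] [IsScalarTower ℝ (Cl n) V] [ContinuousConstSMul (Cl n) V] (a : Cl n) (v : V) :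
    cliffordAction n V a v = a • v := rfl

theorem continuousOn_clifford_smul {S : Set (Pt n)} {a : Pt n → Cl n} {v : Pt n → V}
    (ha : ContinuousOn a S) (hv : ContinuousOn v S) : ContinuousOn (fun y => a y • v y) S :=
  ((cliffordAction n V).continuous.comp_continuousOn ha).clm_apply hv

theorem differentiable_regKernel (s : ℝ) {ε : ℝ} (hε : ε ≠ 0) :
    Differentiable ℝ (regKernel s ε : Pt n → Cl n) := fun z =>
  (hasFDerivAt_regKernel s hε z).differentiableAt

theorem continuousOn_cauchyKernel (s : ℝ) :
    ContinuousOn (cauchyKernel s : Pt n → Cl n) {0}ᶜ := by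
  have h1 : (cauchyKernel s : Pt n → Cl n) =
      fun z => (cauchyConst n / ‖z‖ ^ (n + 1)) • conjParavector s z := funext fun z => by
    rw [cauchyKernel, conjParavector_apply, cauchyConst]
  rw [h1]
  have h2 : ContinuousOn (fun z : Pt n => cauchyConst n / ‖z‖ ^ (n + 1)) {0}ᶜ :=
    continuousOn_const.div (continuous_norm.pow _).continuousOn fun z hz =>
      pow_ne_zero _ (norm_ne_zero_iff.2 hz)
  exact h2.smul (conjParavector s : Pt n →L[ℝ] Cl n).continuous.continuousOn

/-- The vector field with components `E_ε(y - x) u_j g(y)`, whose divergence is the approximate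
identity times `g`. -/
theorem hasContinuousDiv_regKernel {s : ℝ} (hs : s = 1 ∨ s = -1) {Ω : Set (Pt n)}
    (hΩ : IsOpen Ω) {g : Pt n → V} (hgc : ContinuousOn g (closure Ω))
    (hgd : DifferentiableOn ℝ g Ω)
    (hg : ∀ y ∈ Ω, ∑ j, (unit s j : Cl n) • partialDeriv j g y = 0) (x : Pt n) {T : ℝ}
    (hT : 0 < T) :
    HasContinuousDiv Ω (fun j y => (regKernel s T⁻¹ (y - x) * unit s j : Cl n) • g y)
      (fun y => (T ^ (n + 1) * poissonProfile n (T • (x - y))) • g y) := by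
  have hT' : T⁻¹ ≠ 0 := inv_ne_zero hT.ne'
  have hker : Differentiable ℝ fun y => (regKernel s T⁻¹ (y - x) : Cl n) :=
    (differentiable_regKernel s hT').comp (differentiable_id.sub_const x)
  refine ⟨fun j => ?_, fun j => ?_, ?_, fun y hy => ?_⟩
  · exact continuousOn_clifford_smul
      (hker.continuous.mul continuous_const).continuousOn hgc
  · have h1 : Differentiable ℝ fun y => cliffordAction n V (regKernel s T⁻¹ (y - x) * unit s j) :=
      (cliffordAction n V).differentiable.comp (hker.mul_const _)
    exact h1.differentiableOn.clm_apply hgd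
  · refine ContinuousOn.smul (Continuous.continuousOn ?_) hgc
    refine continuous_const.mul (continuous_const.mul (Continuous.rpow_const ?_ fun z => ?_))
    · fun_prop
    · exact Or.inl (by positivity)
  · have hgy : HasFDerivAt g (fderiv ℝ g y) y :=
      (hgd.differentiableAt (hΩ.mem_nhds hy)).hasFDerivAt
    have hE : HasFDerivAt (fun y => (regKernel s T⁻¹ (y - x) : Cl n))
        (fderiv ℝ (regKernel s T⁻¹) (y - x)) y := by
      have h1 := (differentiable_regKernel (n := n) s hT' (y - x)).hasFDerivAt.comp y
        ((hasFDerivAt_id y).sub_const x)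
      exact h1.congr_fderiv (ContinuousLinearMap.comp_id _)
    have hpd : ∀ j, partialDeriv j (fun y => (regKernel s T⁻¹ (y - x) * unit s j : Cl n) • g y) y =
        (partialDeriv j (regKernel s T⁻¹) (y - x) * unit s j : Cl n) • g y +
          (regKernel s T⁻¹ (y - x) : Cl n) • (unit s j : Cl n) • partialDeriv j g y := by
      intro j
      have hL : HasFDerivAt
          (fun y => cliffordAction n V (regKernel s T⁻¹ (y - x) * unit s j)) _ y :=
        (cliffordAction n V).hasFDerivAt.comp y (hE.mul_const' (unit s j))
      have hp : HasFDerivAt (fun y => (regKernel s T⁻¹ (y - x) * unit s j : Cl n) • g y) _ y :=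
        hL.clm_apply hgy
      rw [partialDeriv, hp.fderiv, smul_smul]
      simp [partialDeriv, add_comm]
    simp only [hpd]
    rw [Finset.sum_add_distrib, ← Finset.sum_smul, sum_partialDeriv_regKernel_mul_unit hs hT',
      ← Finset.smul_sum, hg y hy, smul_zero, add_zero, poissonProfile_scale hT, norm_sub_rev,
      algebraMap_smul]

/-- Cauchy's formula for `∑ⱼ uⱼ ∂ⱼ g = 0`: apply the Gauss-Green formula to the regularized kernel
and let the regularization tend to zero. -/
theorem cauchy_formula [CompleteSpace V] {s : ℝ} (hs : s = 1 ∨ s = -1) {Ω : Set (Pt n)}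
    (hΩ : IsNiceDomain Ω) {g : Pt n → V} (hgc : ContinuousOn g (closure Ω))
    (hgd : DifferentiableOn ℝ g Ω)
    (hg : ∀ y ∈ Ω, ∑ j, (unit s j : Cl n) • partialDeriv j g y = 0) {x : Pt n}
    (hx : x ∉ frontier Ω) :
    IntegrableOn (fun y => (cauchyKernel s (y - x) * surfaceElement s Ω y) • g y) (frontier Ω)
      μHE[n] ∧
    ∫ y in frontier Ω, (cauchyKernel s (y - x) * surfaceElement s Ω y) • g y ∂μHE[n] =
      Ω.indicator g x := by
  have hne : ∀ y ∈ frontier Ω, y - x ≠ 0 := fun y hy h => hx (sub_eq_zero.1 h ▸ hy)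
  have hfm : MeasurableSet (frontier Ω) := isClosed_frontier.measurableSet
  have hσ : ContinuousOn (surfaceElement s Ω) (frontier Ω) :=
    (continuous_paravector s).comp_continuousOn (continuousOn_outwardNormal hΩ)
  have hgf := hgc.mono frontier_subset_closure
  have hcont : ContinuousOn (fun y => (cauchyKernel s (y - x) * surfaceElement s Ω y) • g y)
      (frontier Ω) := continuousOn_clifford_smul (((continuousOn_cauchyKernel s).comp
        (by fun_prop) fun y hy => hne y hy).mul hσ) hgf
  have hint := integrableOn_frontier hΩ hcont
  refine ⟨hint, ?_⟩
  set K : ℝ → Pt n → V := fun T y => (regKernel s T⁻¹ (y - x) * surfaceElement s Ω y) • g y with hK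
  have hgreen : ∀ T : ℝ, 0 < T → ∫ y, (T ^ (n + 1) * poissonProfile n (T • (x - y))) •
      Ω.indicator g y = ∫ y in frontier Ω, K T y ∂μHE[n] := by
    intro T hT
    have h1 := (hasContinuousDiv_regKernel hs hΩ.isOpen hgc hgd hg x
      hT).integral_eq_integral_normalFlux hΩ
    simp only [normalFlux, sum_smul_mul_unit] at h1
    rw [hK]
    refine Eq.trans ?_ h1
    rw [← integral_indicator hΩ.isOpen.measurableSet]
    congr 1 with y
    by_cases hy : y ∈ Ω <;> simp [hy]
  have hgi : Integrable (Ω.indicator g) :=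
    ((hgc.integrableOn_compact hΩ.isBounded.isCompact_closure).mono_set
      subset_closure).integrable_indicator hΩ.isOpen.measurableSet
  have hcx : ContinuousAt (Ω.indicator g) x := by
    by_cases hxΩ : x ∈ Ω
    · refine (hgd.differentiableAt (hΩ.isOpen.mem_nhds hxΩ)).continuousAt.congr ?_
      filter_upwards [hΩ.isOpen.mem_nhds hxΩ] with y hy
      rw [indicator_of_mem hy]
    · have hxc : x ∉ closure Ω := fun h => hx (by
        rw [hΩ.isOpen.frontier_eq]
        exact ⟨h, hxΩ⟩)
      refine (continuousAt_const (y := (0 : V))).congr ?_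
      filter_upwards [isClosed_closure.isOpen_compl.mem_nhds hxc] with y hy
      rw [indicator_of_notMem fun h => hy (subset_closure h)]
  have hdim : Module.finrank ℝ (Pt n) = n + 1 := by simp
  have hlim1 := tendsto_integral_comp_smul_smul_of_integrable' (μ := (volume : Measure (Pt n)))
    (poissonProfile_nonneg n) (integral_poissonProfile n)
    (tendsto_norm_pow_mul_poissonProfile n) hgi hcx
  rw [hdim] at hlim1
  have hfac : ∀ T : ℝ, ∀ y ∈ frontier Ω, K T y = (‖y - x‖ ^ (n + 1) * (‖y - x‖ ^ 2 + T⁻¹ ^ 2) ^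
      (-(((n : ℝ) + 1) / 2))) • (cauchyKernel s (y - x) * surfaceElement s Ω y) • g y := by
    intro T y hy
    rw [hK]
    simp only
    rw [regKernel_eq_smul_cauchyKernel s _ (hne y hy), smul_mul_assoc, smul_assoc]
  have hlim2 : Tendsto (fun T => ∫ y in frontier Ω, K T y ∂μHE[n]) atTop
      (𝓝 (∫ y in frontier Ω, (cauchyKernel s (y - x) * surfaceElement s Ω y) • g y ∂μHE[n])) := by
    refine tendsto_integral_filter_of_dominated_convergence _ ?_ ?_ hint.norm ?_
    · filter_upwards [eventually_gt_atTop 0] with T hT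
      have hker : Continuous fun y : Pt n => (regKernel s T⁻¹ (y - x) : Cl n) :=
        (differentiable_regKernel s (inv_ne_zero hT.ne')).continuous.comp (by fun_prop)
      exact (integrableOn_frontier hΩ (continuousOn_clifford_smul (hker.continuousOn.mul hσ)
        hgf)).aestronglyMeasurable
    · refine .of_forall fun T => (ae_restrict_iff' hfm).2 (.of_forall fun y hy => ?_)
      rw [hfac T y hy, norm_smul, Real.norm_of_nonneg (by positivity)]
      exact mul_le_of_le_one_left (norm_nonneg _) (regKernel_factor_le_one _ (hne y hy))
    · refine (ae_restrict_iff' hfm).2 (.of_forall fun y hy => ?_)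
      have h1 := ((tendsto_regKernel_factor (hne y hy)).comp tendsto_inv_atTop_zero).smul_const
        ((cauchyKernel s (y - x) * surfaceElement s Ω y) • g y)
      rw [one_smul] at h1
      exact h1.congr fun T => (hfac T y hy).symm
  refine tendsto_nhds_unique hlim2 (hlim1.congr' ?_)
  filter_upwards [eventually_gt_atTop 0] with T hT using hgreen T hT

end Monogenic

/-! ### Reduction of `D f = M f` to `D g = 0` -/

section Exponential

variable {n : ℕ} {V : Type*} [NormedAddCommGroup V] [NormedSpace ℝ V] [CompleteSpace V]

theorem hasFDerivAt_exp_coord_smul (M : V →L[ℝ] V) (y : Pt n) :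
    HasFDerivAt (fun y : Pt n => NormedSpace.exp (-(y 0) • M))
      (((EuclideanSpace.proj 0 : Pt n →L[ℝ] ℝ)).smulRight
        (-(NormedSpace.exp (-(y 0) • M) * M))) y := by
  have h1 : HasDerivAt (fun t : ℝ => NormedSpace.exp (-t • M))
      (-(NormedSpace.exp (-(y 0) • M) * M)) (y 0) := by
    have h2 := (hasDerivAt_exp_smul_const M (-(y 0))).scomp (y 0) (hasDerivAt_neg (y 0))
    simpa [Function.comp_def] using h2
  have h3 := h1.hasFDerivAt.comp y (EuclideanSpace.proj 0 : Pt n →L[ℝ] ℝ).hasFDerivAt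
  refine h3.congr_fderiv ?_
  ext v : 1
  simp

theorem exp_neg_smul_mul_exp (M : V →L[ℝ] V) (t : ℝ) (v : V) :
    NormedSpace.exp (t • M) (NormedSpace.exp (-t • M) v) = v := by
  let _ : NormedAlgebra ℚ (V →L[ℝ] V) := NormedAlgebra.restrictScalars ℚ ℝ _
  have h := NormedSpace.exp_add_of_commute
    (((Commute.refl M).smul_left t).smul_right (-t))
  rw [← add_smul, add_neg_cancel, zero_smul, NormedSpace.exp_zero] at h
  exact (congrArg (fun L : V →L[ℝ] V => L v) h).symm

/-- Multiplying a solution of `∑ⱼ uⱼ ∂ⱼ f = M f` by `exp (-y₀ M)` gives a solution of the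
homogeneous equation. -/
theorem IsMSolution.sum_unit_smul_partialDeriv_eq_zero [Module (Cl n) V] [IsScalarTower ℝ (Cl n) V]
    [ContinuousConstSMul (Cl n) V] {s : ℝ} {M : V →L[ℝ] V}
    (hM : ∀ (j : Fin n) (v : V), M ((e j : Cl n) • v) = (e j : Cl n) • M v) {Ω : Set (Pt n)}
    (hΩ : IsOpen Ω) {f : Pt n → V} (hf : IsMSolution s M Ω f) {y : Pt n} (hy : y ∈ Ω) :
    ∑ j, (unit s j : Cl n) • partialDeriv j (fun y => NormedSpace.exp (-(y 0) • M) (f y)) y =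
      0 := by
  set A := NormedSpace.exp (-(y 0) • M) with hA
  have hcomm : ∀ (j : Fin n) (v : V), A ((e j : Cl n) • v) = (e j : Cl n) • A v := by
    intro j v
    have h1 : Commute M (cliffordAction n V (e j)) := by
      ext v
      exact hM j v
    exact congrArg (fun L : V →L[ℝ] V => L v) (h1.smul_left (-(y 0))).exp_left
  have hpd : ∀ j, partialDeriv j (fun y => NormedSpace.exp (-(y 0) • M) (f y)) y =
      A (partialDeriv j f y) - if j = 0 then A (M (f y)) else 0 := by
    intro j
    have hp : HasFDerivAt (fun y => NormedSpace.exp (-(y 0) • M) (f y)) _ y :=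
      (hasFDerivAt_exp_coord_smul M y).clm_apply
        (hf.differentiableOn.differentiableAt (hΩ.mem_nhds hy)).hasFDerivAt
    rw [partialDeriv, hp.fderiv]
    by_cases hj : j = 0
    · subst hj
      simp [partialDeriv, hA, sub_eq_add_neg]
    · simp [partialDeriv, hA, hj, Ne.symm hj]
  rw [Fin.sum_univ_succ, hpd 0, if_pos rfl, hf.eqn y hy]
  have hunit : ∀ i : Fin n, (unit s i.succ : Cl n) •
      partialDeriv i.succ (fun y => NormedSpace.exp (-(y 0) • M) (f y)) y =
        A (s • (e i : Cl n) • partialDeriv i.succ f y) := fun i => by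
    rw [hpd, if_neg (Fin.succ_ne_zero i), sub_zero, map_smul, hcomm, unit, Fin.cases_succ,
      smul_assoc]
  rw [Finset.sum_congr rfl fun i _ => hunit i, ← map_sum, ← Finset.smul_sum, unit, Fin.cases_zero,
    one_smul, map_add, map_neg]
  abel

theorem exp_smul_rightMul (l : Cl n) (t : ℝ) (v : Cl n) :
    NormedSpace.exp (t • rightMul l) v = v * NormedSpace.exp (t • l) := by
  have hpow : ∀ k : ℕ, ((t • rightMul l) ^ k) v = v * (t • l) ^ k := by
    intro k
    induction k generalizing v with
    | zero => simp
    | succ k ih =>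
      have h1 : (t • rightMul l) v = v * (t • l) := by simp [rightMul]
      rw [pow_succ]
      change ((t • rightMul l) ^ k) ((t • rightMul l) v) = _
      rw [h1, ih, pow_succ', mul_assoc]
  have h1 := (NormedSpace.exp_series_hasSum_exp' (𝕂 := ℝ) (t • rightMul l)).mapL
    (ContinuousLinearMap.apply ℝ (Cl n) v)
  have h2 := (NormedSpace.exp_series_hasSum_exp' (𝕂 := ℝ) (t • l)).mul_left v
  refine h1.unique (h2.congr_fun ?_)
  intro k
  simp [hpow]

end Exponential

theorem IsMSolution.cauchy_formula {n : ℕ} {V : Type*} [NormedAddCommGroup V] [NormedSpace ℝ V]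
    [CompleteSpace V] [Module (Cl n) V] [IsScalarTower ℝ (Cl n) V]
    [ContinuousConstSMul (Cl n) V] {s : ℝ} (hs : s = 1 ∨ s = -1) {Ω : Set (Pt n)}
    (hΩ : IsNiceDomain Ω) {M : V →L[ℝ] V}
    (hM : ∀ (j : Fin n) (v : V), M ((e j : Cl n) • v) = (e j : Cl n) • M v)
    {f : Pt n → V} (hf : IsMSolution s M Ω f) {x : Pt n} (hx : x ∉ frontier Ω) :
    IntegrableOn (fun y => (cauchyKernel s (y - x) * surfaceElement s Ω y) •
      NormedSpace.exp (-(y 0) • M) (f y)) (frontier Ω) μHE[n] ∧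
    NormedSpace.exp (x 0 • M) (∫ y in frontier Ω,
      (cauchyKernel s (y - x) * surfaceElement s Ω y) •
        NormedSpace.exp (-(y 0) • M) (f y) ∂μHE[n]) = Ω.indicator f x := by
  have hexp : Differentiable ℝ fun y : Pt n => NormedSpace.exp (-(y 0) • M) := fun y =>
    (hasFDerivAt_exp_coord_smul M y).differentiableAt
  obtain ⟨h1, h2⟩ := CliffordCauchy.cauchy_formula hs hΩ
    (g := fun y => NormedSpace.exp (-(y 0) • M) (f y))
    (hexp.continuous.continuousOn.clm_apply hf.continuousOn)
    (hexp.differentiableOn.clm_apply hf.differentiableOn)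
    (fun y hy => hf.sum_unit_smul_partialDeriv_eq_zero hM hΩ.isOpen hy) hx
  refine ⟨h1, ?_⟩
  rw [h2]
  by_cases hxΩ : x ∈ Ω
  · rw [indicator_of_mem hxΩ, indicator_of_mem hxΩ, exp_neg_smul_mul_exp]
  · rw [indicator_of_notMem hxΩ, indicator_of_notMem hxΩ, map_zero]

/-- The formula for right multiplication by `l`: the operator exponentials become factors
`exp (x₀ l)` and `exp (-y₀ l)`, which commute. -/
theorem IsMSolution.cauchy_formula_rightMul {n : ℕ} {s : ℝ} (hs : s = 1 ∨ s = -1) {Ω : Set (Pt n)}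
    (hΩ : IsNiceDomain Ω) {l : Cl n} {f : Pt n → Cl n} (hf : IsMSolution s (rightMul l) Ω f)
    {x : Pt n} (hx : x ∉ frontier Ω) :
    IntegrableOn (fun y => cauchyKernel s (y - x) * surfaceElement s Ω y * f y *
      NormedSpace.exp ((x 0 - y 0) • l)) (frontier Ω) μHE[n] ∧
    ∫ y in frontier Ω, cauchyKernel s (y - x) * surfaceElement s Ω y * f y *
      NormedSpace.exp ((x 0 - y 0) • l) ∂μHE[n] = Ω.indicator f x := by
  obtain ⟨h1, h2⟩ := hf.cauchy_formula hs hΩ (fun j v => by simp [rightMul, mul_assoc]) hx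
  have hexp : ∀ y : Pt n, NormedSpace.exp (x 0 • rightMul l)
      ((cauchyKernel s (y - x) * surfaceElement s Ω y) •
        NormedSpace.exp (-(y 0) • rightMul l) (f y)) =
      cauchyKernel s (y - x) * surfaceElement s Ω y * f y *
        NormedSpace.exp ((x 0 - y 0) • l) := by
    intro y
    let _ : NormedAlgebra ℚ (Cl n) := NormedAlgebra.restrictScalars ℚ ℝ _
    have h := NormedSpace.exp_add_of_commute
      (((Commute.refl l).smul_left (-(y 0))).smul_right (x 0))
    rw [← add_smul, neg_add_eq_sub] at h
    rw [exp_smul_rightMul, exp_smul_rightMul, h, smul_eq_mul]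
    simp only [mul_assoc]
  have h3 := (NormedSpace.exp (x 0 • rightMul l)).integrable_comp h1
  have h4 := (NormedSpace.exp (x 0 • rightMul l)).integral_comp_comm h1
  simp only [hexp] at h3 h4
  exact ⟨h3, h4.trans h2⟩

/-- The formula for a real `r`: the exponential is a central element. -/
theorem IsMSolution.cauchy_formula_real {n : ℕ} {s : ℝ} (hs : s = 1 ∨ s = -1) {Ω : Set (Pt n)}
    (hΩ : IsNiceDomain Ω) {r : ℝ} {f : Pt n → Cl n}
    (hf : IsMSolution s (rightMul (algebraMap ℝ (Cl n) r)) Ω f)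
    {x : Pt n} (hx : x ∉ frontier Ω) :
    IntegrableOn (fun y => cauchyKernel s (y - x) *
      algebraMap ℝ (Cl n) (Real.exp ((x 0 - y 0) * r)) * surfaceElement s Ω y * f y)
      (frontier Ω) μHE[n] ∧
    ∫ y in frontier Ω, cauchyKernel s (y - x) * algebraMap ℝ (Cl n) (Real.exp ((x 0 - y 0) * r)) *
      surfaceElement s Ω y * f y ∂μHE[n] = Ω.indicator f x := by
  have hexp : ∀ y : Pt n, cauchyKernel s (y - x) * surfaceElement s Ω y * f y *
      NormedSpace.exp ((x 0 - y 0) • algebraMap ℝ (Cl n) r) =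
      cauchyKernel s (y - x) * algebraMap ℝ (Cl n) (Real.exp ((x 0 - y 0) * r)) *
        surfaceElement s Ω y * f y := by
    intro y
    have h1 : (x 0 - y 0) • algebraMap ℝ (Cl n) r = algebraMap ℝ (Cl n) ((x 0 - y 0) * r) := by
      rw [map_mul, Algebra.smul_def]
    rw [h1, ← NormedSpace.algebraMap_exp_comm, ← Real.exp_eq_exp_ℝ, mul_assoc (cauchyKernel _ _),
      mul_assoc (cauchyKernel _ _), ← Algebra.commutes]
    simp only [mul_assoc]
  have h := hf.cauchy_formula_rightMul hs hΩ hx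
  simpa only [hexp] using h

end CliffordCauchy

end

open CliffordCauchy in
theorem mainTheorem8 (n : ℕ) (s : ℝ) (hs : s = 1 ∨ s = -1)
    (Ω : Set (Pt n)) (hΩ : IsNiceDomain Ω) :
    (∀ (V : Type*) [NormedAddCommGroup V] [NormedSpace ℝ V] [CompleteSpace V]
        [Module (Cl n) V] [IsScalarTower ℝ (Cl n) V] [ContinuousConstSMul (Cl n) V]
        (M : V →L[ℝ] V) (_ : ∀ (j : Fin n) (v : V), M ((e j : Cl n) • v) = (e j : Cl n) • M v)
        (f : Pt n → V), IsMSolution s M Ω f →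
      (∀ x ∉ frontier Ω, IntegrableOn
        (fun y => (cauchyKernel s (y - x) * surfaceElement s Ω y) •
          NormedSpace.exp (-(y 0) • M) (f y)) (frontier Ω) μHE[n]) ∧
      (∀ x ∈ Ω, NormedSpace.exp (x 0 • M) (∫ y in frontier Ω,
        (cauchyKernel s (y - x) * surfaceElement s Ω y) •
          NormedSpace.exp (-(y 0) • M) (f y) ∂μHE[n]) = f x) ∧
      (∀ x ∉ closure Ω, NormedSpace.exp (x 0 • M) (∫ y in frontier Ω,
        (cauchyKernel s (y - x) * surfaceElement s Ω y) •
          NormedSpace.exp (-(y 0) • M) (f y) ∂μHE[n]) = 0)) ∧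
    (∀ (l : Cl n) (f : Pt n → Cl n), IsMSolution s (rightMul l) Ω f →
      (∀ x ∉ frontier Ω, IntegrableOn
        (fun y => cauchyKernel s (y - x) * surfaceElement s Ω y * f y *
          NormedSpace.exp ((x 0 - y 0) • l)) (frontier Ω) μHE[n]) ∧
      (∀ x ∈ Ω, (∫ y in frontier Ω, cauchyKernel s (y - x) * surfaceElement s Ω y * f y *
          NormedSpace.exp ((x 0 - y 0) • l) ∂μHE[n]) = f x) ∧
      (∀ x ∉ closure Ω, (∫ y in frontier Ω, cauchyKernel s (y - x) * surfaceElement s Ω y * f y *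
          NormedSpace.exp ((x 0 - y 0) • l) ∂μHE[n]) = 0)) ∧
    (∀ (r : ℝ) (f : Pt n → Cl n), IsMSolution s (rightMul (algebraMap ℝ (Cl n) r)) Ω f →
      (∀ x ∉ frontier Ω, IntegrableOn
        (fun y => cauchyKernel s (y - x) * algebraMap ℝ (Cl n) (Real.exp ((x 0 - y 0) * r)) *
          surfaceElement s Ω y * f y) (frontier Ω) μHE[n]) ∧
      (∀ x ∈ Ω, (∫ y in frontier Ω, cauchyKernel s (y - x) *
          algebraMap ℝ (Cl n) (Real.exp ((x 0 - y 0) * r)) *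
          surfaceElement s Ω y * f y ∂μHE[n]) = f x) ∧
      (∀ x ∉ closure Ω, (∫ y in frontier Ω, cauchyKernel s (y - x) *
          algebraMap ℝ (Cl n) (Real.exp ((x 0 - y 0) * r)) *
          surfaceElement s Ω y * f y ∂μHE[n]) = 0)) := by
  have hout : ∀ {x : Pt n}, x ∉ closure Ω → x ∉ Ω := fun hx h => hx (subset_closure h)
  have hfr : ∀ {x : Pt n}, x ∈ Ω → x ∉ frontier Ω := fun hx hf => by
    rw [hΩ.isOpen.frontier_eq] at hf
    exact hf.2 hx
  have hfr' : ∀ {x : Pt n}, x ∉ closure Ω → x ∉ frontier Ω := fun hx hf =>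
    hx (frontier_subset_closure hf)
  refine ⟨?_, ?_, ?_⟩
  · intro V _ _ _ _ _ _ M hM f hf
    refine ⟨fun x hx => (hf.cauchy_formula hs hΩ hM hx).1, fun x hx => ?_, fun x hx => ?_⟩
    · rw [(hf.cauchy_formula hs hΩ hM (hfr hx)).2, Set.indicator_of_mem hx]
    · rw [(hf.cauchy_formula hs hΩ hM (hfr' hx)).2, Set.indicator_of_notMem (hout hx)]
  · intro l f hf
    refine ⟨fun x hx => (hf.cauchy_formula_rightMul hs hΩ hx).1, fun x hx => ?_, fun x hx => ?_⟩
    · rw [(hf.cauchy_formula_rightMul hs hΩ (hfr hx)).2, Set.indicator_of_mem hx]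
    · rw [(hf.cauchy_formula_rightMul hs hΩ (hfr' hx)).2, Set.indicator_of_notMem (hout hx)]
  · intro r f hf
    refine ⟨fun x hx => (hf.cauchy_formula_real hs hΩ hx).1, fun x hx => ?_, fun x hx => ?_⟩
    · rw [(hf.cauchy_formula_real hs hΩ (hfr hx)).2, Set.indicator_of_mem hx]
    · rw [(hf.cauchy_formula_real hs hΩ (hfr' hx)).2, Set.indicator_of_notMem (hout hx)]
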